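/- Let $\mathbb{K}$ be a field, let $\varphi\colon G\to H$ be a homomorphism of abelian groups, and let $A=\bigoplus_{\gamma\in G}A_\gamma$ be a $G$-graded $\mathbb{K}$-algebra. The regraded algebra $\varphi^*(A)$ is the algebra $A$ with the $H$-grading $\varphi^*(A)_\delta=\bigoplus_{\gamma\in\varphi^{-1}(\delta)}A_\gamma$ for $\delta\in H$. Let $A^e=A\otimes_{\mathbb{K}}A^{o}$, with its induced $G$-grading, so that graded $A$-bimodules are the graded left $A^e$-modules. For graded modules $M,N$ let $(\Sigma_\gamma N)_{\gamma'}=N_{\gamma+\gamma'}$ and $\underline{\mathrm{Ext}}^{i,G}_{A^e}(M,N)=\bigoplus_{\gamma\in G}\mathrm{Ext}^i(M,\Sigma_\gamma N)$, where $\mathrm{Ext}^i$ is taken in the abelian category $\mathrm{Mod}^G A^e$ of $G$-graded left $A^e$-modules and degree-preserving maps; $\underline{\mathrm{Ext}}^{i,G}_{A^e}(A,A^e)$ is a graded $A$-bimodule through the right multiplication of $A^e$ on itself. For a degree-preserving algebra automorphism $\mu$ of $A$, let ${}^1\!A^\mu$ be the graded vector space $A$ with the bimodule actions $a*m=am$ and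 $m*a=m\mu(a)$. For an integer $d\ge 0$, the $G$-graded algebra $A$ is *skew $G$-Calabi–Yau of dimension $d$* if (1) $A$ has a bounded projective resolution in $\mathrm{Mod}^G A^e$ with finitely generated terms, and (2) there are a degree-preserving automorphism $\mu$ of $A$ and an $l\in G$ such that, as graded $A$-bimodules, $\underline{\mathrm{Ext}}^{i,G}_{A^e}(A,A^e)=0$ for $i\neq d$ and $\underline{\mathrm{Ext}}^{d,G}_{A^e}(A,A^e)\cong\Sigma_l\,{}^1\!A^\mu$. In this case $\mu$ is called a Nakayama automorphism of $A$ with Gorenstein parameter $l$. If $A$ is skew $G$-Calabi–Yau of dimension $d$, then $\varphi^*(A)$ is skew $H$-Calabi–Yau of dimension $d$. Moreover, whenever $\mu$ is a Nakayama automorphism of $A$ with Gorenstein parameter $l$ (with respect to the $G$-grading), the same map $\mu$ is a Nakayama automorphism of $\varphi^*(A)$ with Gorenstein parameter $\varphi(l)$ (with respect to the $H$-grading). -/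

import Mathlib

open CategoryTheory CategoryTheory.Limits CategoryTheory.Abelian DirectSum TensorProduct

noncomputable section

namespace SkewCY

set_option linter.unusedSectionVars false

universe v v₁ v₂ u w

section Modules

variable {K : Type*} {B : Type u} {G : Type w} [Field K] [Ring B] [Algebra K B]
  [AddCommGroup G] [DecidableEq G]

/-- A `G`-graded left module over an algebra `B` with homogeneous pieces `ℬ γ`.  The pieces of the
module are recorded as additive subgroups; they are automatically `K`-subspaces when `ℬ` is a
grading, because `K` acts through `ℬ 0`. -/
structure GrMod (ℬ : G → Submodule K B) where
  /-- the underlying module -/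
  carrier : Type v
  [addCommGroup : AddCommGroup carrier]
  [module : Module B carrier]
  /-- the homogeneous pieces -/
  gr : G → AddSubgroup carrier
  isInternal : DirectSum.IsInternal gr
  smul_mem : ∀ {i j : G} {b : B} {m : carrier}, b ∈ ℬ i → m ∈ gr j → b • m ∈ gr (i + j)

namespace GrMod

attribute [instance] GrMod.addCommGroup GrMod.module

variable {ℬ : G → Submodule K B}

/-- Morphisms of graded modules: `B`-linear maps that preserve degrees. -/
def homs (M : GrMod.{v₁} ℬ) (N : GrMod.{v₂} ℬ) : AddSubgroup (M.carrier →ₗ[B] N.carrier) where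
  carrier := {f | ∀ i, ∀ m ∈ M.gr i, f m ∈ N.gr i}
  zero_mem' := fun i _ _ => (N.gr i).zero_mem
  add_mem' := fun hf hg i m hm => (N.gr i).add_mem (hf i m hm) (hg i m hm)
  neg_mem' := fun hf i m hm => (N.gr i).neg_mem (hf i m hm)

/-- The category of `G`-graded left `B`-modules. -/
instance : Category.{v} (GrMod.{v} ℬ) where
  Hom M N := homs M N
  id M := ⟨LinearMap.id, fun _ _ hm => hm⟩
  comp f g := ⟨g.1 ∘ₗ f.1, fun i m hm => g.2 i _ (f.2 i m hm)⟩

/-- The linear map underlying a morphism. -/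
def lin {M N : GrMod.{v} ℬ} (f : M ⟶ N) : M.carrier →ₗ[B] N.carrier := f.1

/-- The morphism given by a degree preserving linear map. -/
def ofLin {M N : GrMod.{v} ℬ} (f : M.carrier →ₗ[B] N.carrier)
    (hf : ∀ i, ∀ m ∈ M.gr i, f m ∈ N.gr i) : M ⟶ N := ⟨f, hf⟩

lemma lin_mem {M N : GrMod.{v} ℬ} (f : M ⟶ N) {i : G} {m : M.carrier} (hm : m ∈ M.gr i) :
    lin f m ∈ N.gr i := f.2 i m hm

@[simp] lemma lin_ofLin {M N : GrMod.{v} ℬ} (f : M.carrier →ₗ[B] N.carrier)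
    (hf : ∀ i, ∀ m ∈ M.gr i, f m ∈ N.gr i) : lin (ofLin f hf) = f := rfl

@[simp] lemma lin_id (M : GrMod.{v} ℬ) : lin (𝟙 M) = LinearMap.id := rfl

@[simp] lemma lin_comp {M N P : GrMod.{v} ℬ} (f : M ⟶ N) (g : N ⟶ P) :
    lin (f ≫ g) = lin g ∘ₗ lin f := rfl

lemma hom_ext {M N : GrMod.{v} ℬ} {f g : M ⟶ N} (h : ∀ x, lin f x = lin g x) : f = g :=
  Subtype.ext (LinearMap.ext h)

instance : Preadditive (GrMod.{v} ℬ) where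
  homGroup M N := inferInstanceAs (AddCommGroup (homs M N))
  add_comp _ _ _ f f' g := hom_ext fun x => map_add (lin g) (lin f x) (lin f' x)
  comp_add _ _ _ _ _ _ := rfl

@[simp] lemma lin_add {M N : GrMod.{v} ℬ} (f g : M ⟶ N) : lin (f + g) = lin f + lin g := rfl

@[simp] lemma lin_zero {M N : GrMod.{v} ℬ} : lin (0 : M ⟶ N) = 0 := rfl

/-- The additive projection onto a homogeneous piece. -/
def proj (M : GrMod.{v} ℬ) (i : G) : M.carrier →+ M.carrier :=
  letI := M.isInternal.chooseDecomposition
  (M.gr i).subtype.comp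
    ((DFinsupp.evalAddMonoidHom i).comp (DirectSum.decomposeAddEquiv M.gr).toAddMonoidHom)

lemma proj_mem (M : GrMod.{v} ℬ) (i : G) (x : M.carrier) : M.proj i x ∈ M.gr i :=
  SetLike.coe_mem _

lemma proj_same (M : GrMod.{v} ℬ) {i : G} {x : M.carrier} (hx : x ∈ M.gr i) :
    M.proj i x = x := by
  let _ := M.isInternal.chooseDecomposition
  exact DirectSum.decompose_of_mem_same M.gr hx

lemma proj_ne (M : GrMod.{v} ℬ) {i j : G} {x : M.carrier} (hx : x ∈ M.gr j) (h : j ≠ i) :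
    M.proj i x = 0 := by
  let _ := M.isInternal.chooseDecomposition
  exact DirectSum.decompose_of_mem_ne M.gr hx h

lemma induction (M : GrMod.{v} ℬ) {p : M.carrier → Prop} (x : M.carrier) (zero : p 0)
    (mem : ∀ i, ∀ x ∈ M.gr i, p x) (add : ∀ x y, p x → p y → p (x + y)) : p x := by
  let _ := M.isInternal.chooseDecomposition
  exact DirectSum.Decomposition.inductionOn M.gr zero (fun m => mem _ _ m.2) add x

lemma mem_span (M : GrMod.{v} ℬ) {S : AddSubgroup M.carrier} {x : M.carrier}
    (h : ∀ i, M.proj i x ∈ S) : x ∈ S := by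
  let _ := M.isInternal.chooseDecomposition
  classical
  rw [← DirectSum.sum_support_decompose M.gr x]
  exact S.sum_mem fun i _ => h i

lemma lin_proj {M N : GrMod.{v} ℬ} (f : M ⟶ N) (i : G) (x : M.carrier) :
    lin f (M.proj i x) = N.proj i (lin f x) := by
  refine M.induction (p := fun x => lin f (M.proj i x) = N.proj i (lin f x)) x (by simp) (fun j x hx => ?_)
    (fun x y hx hy => by simp [hx, hy])
  by_cases h : j = i
  · subst h
    rw [proj_same M hx, proj_same N (lin_mem f hx)]
  · rw [proj_ne M hx h, proj_ne N (lin_mem f hx) h, map_zero]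

end GrMod

/-- A criterion for an additive group to be the internal direct sum of subgroups. -/
lemma isInternal_of_proj {ι M : Type*} [DecidableEq ι] [AddCommGroup M] (gr : ι → AddSubgroup M)
    (p : ι → M →+ M) (hsame : ∀ i, ∀ x ∈ gr i, p i x = x)
    (hne : ∀ i j, j ≠ i → ∀ x ∈ gr j, p i x = 0)
    (hspan : ∀ S : AddSubgroup M, (∀ i, gr i ≤ S) → ∀ x, x ∈ S) : DirectSum.IsInternal gr := by
  have key : ∀ (y : ⨁ i, gr i) (i : ι), p i (DirectSum.coeAddMonoidHom gr y) = (y i : M) := by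
    intro y i
    induction y using DirectSum.induction_on with
    | zero => simp
    | of j x =>
      rw [DirectSum.coeAddMonoidHom_of]
      by_cases h : j = i
      · subst h
        rw [hsame _ _ x.2, DirectSum.of_eq_same]
      · rw [hne _ _ h _ x.2, DirectSum.of_eq_of_ne _ _ _ (Ne.symm h)]; rfl
    | add x y hx hy => simp [hx, hy]
  constructor
  · intro y z h
    refine DFinsupp.ext fun i => Subtype.ext ?_
    rw [← key, ← key, h]
  · intro x
    refine hspan (DirectSum.coeAddMonoidHom gr).range (fun i z hz => ?_) x
    exact ⟨DirectSum.of (fun i => gr i) i ⟨z, hz⟩, DirectSum.coeAddMonoidHom_of _ _ _⟩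

namespace GrMod

variable {ℬ : G → Submodule K B}

/-- The kernel of a morphism, with the induced grading. -/
def ker {M N : GrMod.{v} ℬ} (f : M ⟶ N) : GrMod.{v} ℬ where
  carrier := LinearMap.ker (lin f)
  gr i := (M.gr i).comap (LinearMap.ker (lin f)).subtype.toAddMonoidHom
  isInternal := by
    have hp : ∀ i, ∀ x ∈ LinearMap.ker (lin f), M.proj i x ∈ LinearMap.ker (lin f) := by
      intro i x hx
      rw [LinearMap.mem_ker] at hx ⊢
      rw [lin_proj, hx, map_zero]
    refine isInternal_of_proj _ (fun i => AddMonoidHom.mk' (fun x => ⟨M.proj i x, hp i x x.2⟩)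
      (fun x y => Subtype.ext (map_add (M.proj i) _ _))) ?_ ?_ ?_
    · intro i x hx
      exact Subtype.ext (proj_same M hx)
    · intro i j h x hx
      exact Subtype.ext (proj_ne M hx h)
    · intro S hS x
      have : (x : M.carrier) ∈ S.map (LinearMap.ker (lin f)).subtype.toAddMonoidHom := by
        refine M.mem_span fun i => ⟨⟨M.proj i x, hp i x x.2⟩, hS i ?_, rfl⟩
        exact M.proj_mem i x
      obtain ⟨y, hy, hyx⟩ := this
      have : y = x := Subtype.ext hyx
      exact this ▸ hy
  smul_mem := fun hb hm => M.smul_mem hb hm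

/-- The cokernel of a morphism, with the induced grading. -/
def coker {M N : GrMod.{v} ℬ} (f : M ⟶ N) : GrMod.{v} ℬ where
  carrier := N.carrier ⧸ LinearMap.range (lin f)
  gr i := (N.gr i).map (LinearMap.range (lin f)).mkQ.toAddMonoidHom
  isInternal := by
    have hp : ∀ i, (LinearMap.range (lin f)).toAddSubgroup ≤
        ((LinearMap.range (lin f)).mkQ.toAddMonoidHom.comp (N.proj i)).ker := by
      rintro i _ ⟨y, rfl⟩
      rw [AddMonoidHom.mem_ker]
      refine (Submodule.Quotient.mk_eq_zero _).2 ?_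
      rw [← lin_proj]
      exact ⟨_, rfl⟩
    refine isInternal_of_proj _ (fun i => QuotientAddGroup.lift _ _ (hp i)) ?_ ?_ ?_
    · rintro i _ ⟨x, hx, rfl⟩
      exact congrArg (LinearMap.range (lin f)).mkQ (proj_same N hx)
    · rintro i j h _ ⟨x, hx, rfl⟩
      exact (congrArg (LinearMap.range (lin f)).mkQ (proj_ne N hx h)).trans (map_zero _)
    · intro S hS x
      obtain ⟨x, rfl⟩ := (LinearMap.range (lin f)).mkQ_surjective x
      have : x ∈ S.comap (LinearMap.range (lin f)).mkQ.toAddMonoidHom :=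
        N.mem_span fun i => hS i ⟨_, N.proj_mem i x, rfl⟩
      exact this
  smul_mem := by
    rintro i j b _ hb ⟨m, hm, rfl⟩
    exact ⟨b • m, N.smul_mem hb hm, rfl⟩

/-- The direct sum of two graded modules. -/
def prod (M N : GrMod.{v} ℬ) : GrMod.{v} ℬ where
  carrier := M.carrier × N.carrier
  gr i := (M.gr i).prod (N.gr i)
  isInternal := by
    refine isInternal_of_proj _ (fun i => (M.proj i).prodMap (N.proj i)) ?_ ?_ ?_
    · rintro i ⟨x, y⟩ ⟨hx, hy⟩
      exact Prod.ext (proj_same M hx) (proj_same N hy)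
    · rintro i j h ⟨x, y⟩ ⟨hx, hy⟩
      exact Prod.ext (proj_ne M hx h) (proj_ne N hy h)
    · rintro S hS ⟨x, y⟩
      have h1 : x ∈ S.comap (AddMonoidHom.inl M.carrier N.carrier) :=
        M.mem_span fun i => hS i ⟨M.proj_mem i x, (N.gr i).zero_mem⟩
      have h2 : y ∈ S.comap (AddMonoidHom.inr M.carrier N.carrier) :=
        N.mem_span fun i => hS i ⟨(M.gr i).zero_mem, N.proj_mem i y⟩
      have := S.add_mem (AddSubgroup.mem_comap.1 h1) (AddSubgroup.mem_comap.1 h2)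
      simpa using this
  smul_mem := fun hb hm => ⟨M.smul_mem hb hm.1, N.smul_mem hb hm.2⟩

/-- The zero graded module. -/
def zero (ℬ : G → Submodule K B) : GrMod.{v} ℬ where
  carrier := PUnit.{v + 1}
  gr _ := ⊤
  isInternal := isInternal_of_proj _ (fun _ => 0) (fun _ _ _ => rfl) (fun _ _ _ _ _ => rfl)
    (fun S _ _ => S.zero_mem)
  smul_mem := fun _ _ => trivial

instance : HasZeroObject (GrMod.{v} ℬ) :=
  ⟨zero ℬ, (IsZero.iff_id_eq_zero _).2 (hom_ext fun _ => rfl)⟩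

/-- The kernel fork of a morphism. -/
def kerFork {M N : GrMod.{v} ℬ} (f : M ⟶ N) : KernelFork f :=
  KernelFork.ofι (Z := ker f) (ofLin (LinearMap.ker (lin f)).subtype fun _ _ hm => hm)
    (hom_ext fun x => x.2)

/-- The kernel fork is universal. -/
def kerForkIsLimit {M N : GrMod.{v} ℬ} (f : M ⟶ N) : IsLimit (kerFork f) :=
  KernelFork.IsLimit.ofι _ (KernelFork.condition (kerFork f))
    (fun g hg => ofLin (N := ker f) (LinearMap.codRestrict _ (lin g) fun x =>
      congrArg (fun h => lin h x) hg) fun _ _ hm => lin_mem g hm)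
    (fun _ _ => rfl)
    (fun _ _ _ hm => hom_ext fun x => Subtype.ext (congrArg (fun h => lin h x) hm))

instance : HasKernels (GrMod.{v} ℬ) := ⟨fun f => ⟨⟨_, kerForkIsLimit f⟩⟩⟩

/-- The cokernel cofork of a morphism. -/
def cokerCofork {M N : GrMod.{v} ℬ} (f : M ⟶ N) : CokernelCofork f :=
  CokernelCofork.ofπ (Z := coker f)
    (ofLin (N := coker f) (LinearMap.range (lin f)).mkQ fun _ m hm => ⟨m, hm, rfl⟩)
    (hom_ext fun x => (Submodule.Quotient.mk_eq_zero _).2 ⟨x, rfl⟩)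

/-- The cokernel cofork is universal. -/
def cokerCoforkIsColimit {M N : GrMod.{v} ℬ} (f : M ⟶ N) : IsColimit (cokerCofork f) :=
  CokernelCofork.IsColimit.ofπ _ (CokernelCofork.condition (cokerCofork f))
    (fun g hg => ofLin (M := coker f) ((LinearMap.range (lin f)).liftQ (lin g) (by
        rintro _ ⟨x, rfl⟩
        exact congrArg (fun h => lin h x) hg))
      (by
        rintro i _ ⟨m, hm, rfl⟩
        exact lin_mem g hm))
    (fun _ _ => rfl)
    (fun g hg m hm => hom_ext fun x => by
      obtain ⟨x, rfl⟩ := (LinearMap.range (lin f)).mkQ_surjective x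
      exact congrArg (fun h => lin h x) hm)

instance : HasCokernels (GrMod.{v} ℬ) := ⟨fun f => ⟨⟨_, cokerCoforkIsColimit f⟩⟩⟩

instance : HasBinaryBiproducts (GrMod.{v} ℬ) where
  has_binary_biproduct M N := hasBinaryBiproduct_of_total
    { pt := prod M N
      fst := ofLin (M := prod M N) (LinearMap.fst B _ _) fun _ _ hm => hm.1
      snd := ofLin (M := prod M N) (LinearMap.snd B _ _) fun _ _ hm => hm.2
      inl := ofLin (N := prod M N) (LinearMap.inl B _ _) fun i _ hm => ⟨hm, (N.gr i).zero_mem⟩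
      inr := ofLin (N := prod M N) (LinearMap.inr B _ _) fun i _ hm => ⟨(M.gr i).zero_mem, hm⟩
      inl_fst := rfl
      inl_snd := rfl
      inr_fst := rfl
      inr_snd := rfl }
    (hom_ext fun x => Prod.ext (add_zero x.1) (zero_add x.2))

instance : HasFiniteProducts (GrMod.{v} ℬ) := hasFiniteProducts_of_has_binary_and_terminal

lemma injective_of_mono {M N : GrMod.{v} ℬ} (f : M ⟶ N) [Mono f] :
    Function.Injective (lin f) := by
  rw [← LinearMap.ker_eq_bot, eq_bot_iff]
  intro x hx
  have h : (kerFork f).ι = 0 := (cancel_mono f).1 (by rw [KernelFork.condition, zero_comp])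
  exact congrArg (fun g : ker f ⟶ M => lin g ⟨x, hx⟩) h

lemma surjective_of_epi {M N : GrMod.{v} ℬ} (f : M ⟶ N) [Epi f] :
    Function.Surjective (lin f) := by
  rw [← LinearMap.range_eq_top, eq_top_iff]
  intro x _
  have h : (cokerCofork f).π = 0 :=
    (cancel_epi f).1 (by rw [CokernelCofork.condition, comp_zero])
  exact (Submodule.Quotient.mk_eq_zero _).1 (congrArg (fun g => lin g x) h)

lemma mem_of_injective {M N : GrMod.{v} ℬ} (f : M ⟶ N) (hf : Function.Injective (lin f)) {i : G}
    {x : M.carrier} (hx : lin f x ∈ N.gr i) : x ∈ M.gr i := by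
  have : M.proj i x = x := hf (by rw [lin_proj, proj_same N hx])
  exact this ▸ M.proj_mem i x

/-- The category of graded modules is abelian. -/
instance : Abelian (GrMod.{v} ℬ) where
  normalMonoOfMono {M N} f _ := ⟨{
    Z := coker f
    g := (cokerCofork f).π
    w := CokernelCofork.condition _
    isLimit := by
      have hf := injective_of_mono f
      have hr : ∀ {P : GrMod.{v} ℬ} (g : P ⟶ N) (_ : g ≫ (cokerCofork f).π = 0) (x : P.carrier),
          lin g x ∈ LinearMap.range (lin f) := fun g hg x =>
        (Submodule.Quotient.mk_eq_zero _).1 (congrArg (fun h => lin h x) hg)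
      have hl : ∀ {P : GrMod.{v} ℬ} (g : P ⟶ N) (hg : g ≫ (cokerCofork f).π = 0) (x : P.carrier),
          lin f ((LinearEquiv.ofInjective (lin f) hf).symm ⟨lin g x, hr g hg x⟩) = lin g x :=
        fun g hg x => congrArg Subtype.val
          ((LinearEquiv.ofInjective (lin f) hf).apply_symm_apply ⟨lin g x, hr g hg x⟩)
      exact KernelFork.IsLimit.ofι _ _
        (fun {P} g hg => ofLin ((LinearEquiv.ofInjective (lin f) hf).symm.toLinearMap ∘ₗ
            LinearMap.codRestrict _ (lin g) (hr g hg))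
          (fun i x hx => mem_of_injective f hf (by
            have := hl g hg x
            exact this ▸ lin_mem g hx)))
        (fun g hg => hom_ext fun x => hl g hg x)
        (fun g hg m hm => hom_ext fun x => hf
          ((congrArg (fun h => lin h x) hm).trans (hl g hg x).symm)) }⟩
  normalEpiOfEpi {M N} f _ := ⟨{
    W := ker f
    g := (kerFork f).ι
    w := KernelFork.condition _
    isColimit := by
      have hf := surjective_of_epi f
      have hk : ∀ {P : GrMod.{v} ℬ} (g : M ⟶ P) (_ : (kerFork f).ι ≫ g = 0),
          LinearMap.ker (lin f) ≤ LinearMap.ker (lin g) := fun {P} g hg x hx =>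
        congrArg (fun h : ker f ⟶ P => lin h ⟨x, hx⟩) hg
      have hl : ∀ {P : GrMod.{v} ℬ} (g : M ⟶ P) (hg : (kerFork f).ι ≫ g = 0) (x : M.carrier),
          (LinearMap.ker (lin f)).liftQ (lin g) (hk g hg)
            (((lin f).quotKerEquivOfSurjective hf).symm (lin f x)) = lin g x := by
        intro P g hg x
        have : ((lin f).quotKerEquivOfSurjective hf).symm (lin f x) =
            (LinearMap.ker (lin f)).mkQ x := by
          rw [LinearEquiv.symm_apply_eq]; rfl
        rw [this]; rfl
      exact CokernelCofork.IsColimit.ofπ _ _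
        (fun {P} g hg => ofLin ((LinearMap.ker (lin f)).liftQ (lin g) (hk g hg) ∘ₗ
            ((lin f).quotKerEquivOfSurjective hf).symm.toLinearMap)
          (fun i y hy => by
            obtain ⟨x, rfl⟩ := hf y
            have h1 : lin f (M.proj i x) = lin f x := by rw [lin_proj, proj_same N hy]
            rw [← h1]
            have := hl g hg (M.proj i x)
            exact this.symm ▸ lin_mem g (M.proj_mem i x)))
        (fun g hg => hom_ext fun x => hl g hg x)
        (fun g hg m hm => hom_ext fun y => by
          obtain ⟨x, rfl⟩ := hf y
          exact (congrArg (fun h => lin h x) hm).trans (hl g hg x).symm) }⟩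

instance : HasExt.{max w u (v + 1)} (GrMod.{v} ℬ) := HasExt.standard _

end GrMod

end Modules

section Gradings

variable {K : Type*} {A : Type u} [Field K] [Ring A] [Algebra K A]
  {G : Type*} [AddCommGroup G] {H : Type*} [AddCommGroup H]

/-- A linear map that sends every element of a piece to the corresponding element of the direct
sum is a decomposition, provided that the pieces span. -/
@[reducible]
def decompositionOf {ι M : Type*} [DecidableEq ι] [AddCommGroup M] [Module K M]
    (ℳ : ι → Submodule K M) (D : M →ₗ[K] ⨁ i, ℳ i)
    (hD : ∀ i, ∀ x : ℳ i, D x = DirectSum.lof K ι (fun i => ℳ i) i x)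
    (hspan : ∀ S : Submodule K M, (∀ i, ℳ i ≤ S) → ∀ x, x ∈ S) : DirectSum.Decomposition ℳ :=
  DirectSum.Decomposition.ofLinearMap ℳ D
    (LinearMap.ext fun x =>
      hspan (LinearMap.eqLocus (DirectSum.coeLinearMap ℳ ∘ₗ D) LinearMap.id) (fun i x hx => by
        rw [LinearMap.mem_eqLocus, LinearMap.comp_apply, hD i ⟨x, hx⟩, DirectSum.coeLinearMap_lof]
        rfl) x)
    (DirectSum.linearMap_ext K fun i => LinearMap.ext fun x => by
      rw [LinearMap.comp_apply, LinearMap.comp_apply, DirectSum.coeLinearMap_lof, hD]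
      rfl)

lemma mem_of_decomposition {ι M : Type*} [DecidableEq ι] [AddCommGroup M] [Module K M]
    (ℳ : ι → Submodule K M) [DirectSum.Decomposition ℳ] {S : Submodule K M}
    (h : ∀ i, ℳ i ≤ S) (x : M) : x ∈ S :=
  DirectSum.Decomposition.inductionOn ℳ S.zero_mem (fun m => h _ m.2)
    (fun _ _ => S.add_mem) x

/-- The regrading of a grading along a group homomorphism `φ : G → H`: its piece of degree `δ` is
the sum of the pieces of degrees `γ` with `φ γ = δ`. -/
def regrade (φ : G →+ H) (𝒜 : G → Submodule K A) : H → Submodule K A :=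
  fun δ => ⨆ (γ : G) (_ : φ γ = δ), 𝒜 γ

lemma mem_regrade (φ : G →+ H) (𝒜 : G → Submodule K A) {γ : G} {δ : H} (h : φ γ = δ) {a : A}
    (ha : a ∈ 𝒜 γ) : a ∈ regrade φ 𝒜 δ :=
  Submodule.mem_iSup_of_mem γ (Submodule.mem_iSup_of_mem h ha)

lemma regrade_le (φ : G →+ H) (𝒜 : G → Submodule K A) {δ : H} {S : Submodule K A}
    (h : ∀ γ, φ γ = δ → 𝒜 γ ≤ S) : regrade φ 𝒜 δ ≤ S :=
  iSup_le fun γ => iSup_le fun hγ => h γ hγ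

instance regrade.gradedMonoid (φ : G →+ H) (𝒜 : G → Submodule K A) [SetLike.GradedMonoid 𝒜] :
    SetLike.GradedMonoid (regrade φ 𝒜) where
  one_mem := mem_regrade φ 𝒜 (map_zero φ) SetLike.GradedOne.one_mem
  mul_mem := by
    intro i j a b ha hb
    have h1 : regrade φ 𝒜 i ≤ (regrade φ 𝒜 (i + j)).comap (LinearMap.mulRight K b) := by
      refine regrade_le φ 𝒜 fun γ hγ a ha => ?_
      have h2 : regrade φ 𝒜 j ≤ (regrade φ 𝒜 (i + j)).comap (LinearMap.mulLeft K a) := by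
        refine regrade_le φ 𝒜 fun γ' hγ' b hb => ?_
        exact mem_regrade φ 𝒜 (by rw [map_add, hγ, hγ']) (SetLike.GradedMul.mul_mem ha hb)
      exact h2 hb
    exact h1 ha

instance regrade.decomposition [DecidableEq G] [DecidableEq H] (φ : G →+ H)
    (𝒜 : G → Submodule K A) [DirectSum.Decomposition 𝒜] : DirectSum.Decomposition (regrade φ 𝒜) := by
  let D : A →ₗ[K] ⨁ δ, regrade φ 𝒜 δ :=
    (DirectSum.toModule K G _ fun γ =>
      (DirectSum.lof K H (fun δ => regrade φ 𝒜 δ) (φ γ)) ∘ₗ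
        Submodule.inclusion (fun _ ha => mem_regrade φ 𝒜 rfl ha)) ∘ₗ
      (DirectSum.decomposeLinearEquiv 𝒜).toLinearMap
  have hD : ∀ (γ : G) (δ : H) (h : φ γ = δ) (a : A) (ha : a ∈ 𝒜 γ),
      D a = DirectSum.lof K H (fun δ => regrade φ 𝒜 δ) δ ⟨a, mem_regrade φ 𝒜 h ha⟩ := by
    intro γ δ h a ha
    subst h
    have : DirectSum.decomposeLinearEquiv 𝒜 a = DirectSum.lof K G (fun γ => 𝒜 γ) γ ⟨a, ha⟩ :=
      DirectSum.decompose_of_mem 𝒜 ha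
    simp only [D, LinearMap.comp_apply, LinearEquiv.coe_coe, this, DirectSum.toModule_lof]
    rfl
  refine decompositionOf _ D (fun δ x => ?_) (fun S hS x => ?_)
  · let L : Submodule K A := (LinearMap.eqLocus (D ∘ₗ (regrade φ 𝒜 δ).subtype)
      (DirectSum.lof K H (fun δ => regrade φ 𝒜 δ) δ)).map (regrade φ 𝒜 δ).subtype
    have hL : regrade φ 𝒜 δ ≤ L :=
      regrade_le φ 𝒜 fun γ hγ a ha => ⟨⟨a, mem_regrade φ 𝒜 hγ ha⟩, hD γ δ hγ a ha, rfl⟩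
    obtain ⟨y, hy, hyx⟩ := hL x.2
    have : y = x := Subtype.ext hyx
    subst this
    exact hy
  · exact mem_of_decomposition 𝒜 (fun γ a ha => hS (φ γ) (mem_regrade φ 𝒜 rfl ha)) x

/-- The regraded algebra is again a graded algebra. -/
instance regrade.gradedAlgebra [DecidableEq G] [DecidableEq H] (φ : G →+ H)
    (𝒜 : G → Submodule K A) [GradedAlgebra 𝒜] : GradedAlgebra (regrade φ 𝒜) where
  __ := regrade.gradedMonoid φ 𝒜
  __ := regrade.decomposition φ 𝒜

/-- The grading of the opposite algebra. -/
def opGrading (𝒜 : G → Submodule K A) : G → Submodule K Aᵐᵒᵖ :=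
  fun γ => (𝒜 γ).comap (MulOpposite.opLinearEquiv K).symm.toLinearMap

lemma mem_opGrading {𝒜 : G → Submodule K A} {γ : G} {a : Aᵐᵒᵖ} :
    a ∈ opGrading 𝒜 γ ↔ a.unop ∈ 𝒜 γ := Iff.rfl

instance opGrading.gradedMonoid (𝒜 : G → Submodule K A) [SetLike.GradedMonoid 𝒜] :
    SetLike.GradedMonoid (opGrading 𝒜) where
  one_mem := mem_opGrading.2 SetLike.GradedOne.one_mem
  mul_mem := fun i j a b ha hb => mem_opGrading.2 (by
    rw [add_comm i j, MulOpposite.unop_mul]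
    exact SetLike.GradedMul.mul_mem (mem_opGrading.1 hb) (mem_opGrading.1 ha))

instance opGrading.decomposition [DecidableEq G] (𝒜 : G → Submodule K A)
    [DirectSum.Decomposition 𝒜] : DirectSum.Decomposition (opGrading 𝒜) := by
  let E : ∀ γ, 𝒜 γ →ₗ[K] opGrading 𝒜 γ := fun γ =>
    LinearMap.codRestrict _
      ((MulOpposite.opLinearEquiv K : A ≃ₗ[K] Aᵐᵒᵖ).toLinearMap ∘ₗ (𝒜 γ).subtype) (fun a => a.2)
  refine decompositionOf _ (DirectSum.lmap E ∘ₗ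
    (DirectSum.decomposeLinearEquiv 𝒜).toLinearMap ∘ₗ
      (MulOpposite.opLinearEquiv K).symm.toLinearMap) (fun γ x => ?_) (fun S hS x => ?_)
  · have h : DirectSum.decomposeLinearEquiv 𝒜 (MulOpposite.unop (x : Aᵐᵒᵖ)) =
        DirectSum.lof K G (fun γ => 𝒜 γ) γ ⟨MulOpposite.unop (x : Aᵐᵒᵖ), x.2⟩ :=
      DirectSum.decompose_of_mem 𝒜 x.2
    simp only [LinearMap.comp_apply, LinearEquiv.coe_coe, MulOpposite.coe_opLinearEquiv_symm, h,
      DirectSum.lmap_lof]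
    rfl
  · exact mem_of_decomposition 𝒜
      (S := S.comap (MulOpposite.opLinearEquiv K : A ≃ₗ[K] Aᵐᵒᵖ).toLinearMap)
      (fun γ a ha => hS γ (mem_opGrading.2 ha)) x.unop

instance opGrading.gradedAlgebra [DecidableEq G] (𝒜 : G → Submodule K A) [GradedAlgebra 𝒜] :
    GradedAlgebra (opGrading 𝒜) where
  __ := opGrading.gradedMonoid 𝒜
  __ := opGrading.decomposition 𝒜

/-- The `G × G`-grading of the enveloping algebra `Aᵉ = A ⊗ Aᵒᵖ` by the images of `A_α ⊗ A_β`. -/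
def biGrading (𝒜 : G → Submodule K A) : G × G → Submodule K (A ⊗[K] Aᵐᵒᵖ) :=
  fun p => LinearMap.range (TensorProduct.map (𝒜 p.1).subtype (opGrading 𝒜 p.2).subtype)

lemma tmul_mem_biGrading {𝒜 : G → Submodule K A} {α β : G} {a : A} {b : Aᵐᵒᵖ}
    (ha : a ∈ 𝒜 α) (hb : b ∈ opGrading 𝒜 β) : a ⊗ₜ[K] b ∈ biGrading 𝒜 (α, β) :=
  ⟨(⟨a, ha⟩ : 𝒜 α) ⊗ₜ (⟨b, hb⟩ : opGrading 𝒜 β), rfl⟩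

lemma biGrading_le {𝒜 : G → Submodule K A} {p : G × G} {S : Submodule K (A ⊗[K] Aᵐᵒᵖ)}
    (h : ∀ a ∈ 𝒜 p.1, ∀ b ∈ opGrading 𝒜 p.2, a ⊗ₜ[K] b ∈ S) : biGrading 𝒜 p ≤ S := by
  rintro _ ⟨t, rfl⟩
  induction t with
  | zero => simp
  | tmul a b => exact h a a.2 b b.2
  | add x y hx hy => rw [map_add]; exact S.add_mem hx hy

instance biGrading.gradedMonoid (𝒜 : G → Submodule K A) [SetLike.GradedMonoid 𝒜] :
    SetLike.GradedMonoid (biGrading 𝒜) where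
  one_mem := tmul_mem_biGrading SetLike.GradedOne.one_mem SetLike.GradedOne.one_mem
  mul_mem := by
    intro p q x y hx hy
    have h1 : biGrading 𝒜 p ≤ (biGrading 𝒜 (p + q)).comap (LinearMap.mulRight K y) := by
      refine biGrading_le fun a ha b hb => ?_
      have h2 : biGrading 𝒜 q ≤
          (biGrading 𝒜 (p + q)).comap (LinearMap.mulLeft K (a ⊗ₜ[K] b)) := by
        refine biGrading_le fun a' ha' b' hb' => ?_
        rw [Submodule.mem_comap, LinearMap.mulLeft_apply, Algebra.TensorProduct.tmul_mul_tmul]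
        exact tmul_mem_biGrading (SetLike.GradedMul.mul_mem ha ha')
          (SetLike.GradedMul.mul_mem hb hb')
      exact h2 hy
    exact h1 hx

instance biGrading.decomposition [DecidableEq G] (𝒜 : G → Submodule K A)
    [DirectSum.Decomposition 𝒜] : DirectSum.Decomposition (biGrading 𝒜) := by
  let E : ∀ p : G × G, (𝒜 p.1 ⊗[K] opGrading 𝒜 p.2) →ₗ[K] biGrading 𝒜 p := fun p =>
    (TensorProduct.map (𝒜 p.1).subtype (opGrading 𝒜 p.2).subtype).rangeRestrict
  let D : A ⊗[K] Aᵐᵒᵖ →ₗ[K] ⨁ p, biGrading 𝒜 p :=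
    DirectSum.lmap E ∘ₗ (TensorProduct.directSum K K (fun γ => 𝒜 γ)
      (fun γ => opGrading 𝒜 γ)).toLinearMap ∘ₗ
      TensorProduct.map (DirectSum.decomposeLinearEquiv 𝒜).toLinearMap
        (DirectSum.decomposeLinearEquiv (opGrading 𝒜)).toLinearMap
  have hD : ∀ (p : G × G) (a : A) (ha : a ∈ 𝒜 p.1) (b : Aᵐᵒᵖ) (hb : b ∈ opGrading 𝒜 p.2),
      D (a ⊗ₜ b) = DirectSum.lof K (G × G) (fun p => biGrading 𝒜 p) p
        ⟨a ⊗ₜ b, tmul_mem_biGrading ha hb⟩ := by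
    intro p a ha b hb
    have h1 : DirectSum.decomposeLinearEquiv 𝒜 a =
        DirectSum.lof K G (fun γ => 𝒜 γ) p.1 ⟨a, ha⟩ := DirectSum.decompose_of_mem 𝒜 ha
    have h2 : DirectSum.decomposeLinearEquiv (opGrading 𝒜) b =
        DirectSum.lof K G (fun γ => opGrading 𝒜 γ) p.2 ⟨b, hb⟩ :=
      DirectSum.decompose_of_mem (opGrading 𝒜) hb
    simp only [D, LinearMap.comp_apply, LinearEquiv.coe_coe, TensorProduct.map_tmul, h1, h2,
      TensorProduct.directSum_lof_tmul_lof, DirectSum.lmap_lof]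
    rfl
  refine decompositionOf _ D (fun p x => ?_) (fun S hS x => ?_)
  · let L : Submodule K (A ⊗[K] Aᵐᵒᵖ) := (LinearMap.eqLocus (D ∘ₗ (biGrading 𝒜 p).subtype)
      (DirectSum.lof K (G × G) (fun p => biGrading 𝒜 p) p)).map (biGrading 𝒜 p).subtype
    have hL : biGrading 𝒜 p ≤ L := biGrading_le fun a ha b hb =>
      ⟨⟨a ⊗ₜ b, tmul_mem_biGrading ha hb⟩, hD p a ha b hb, rfl⟩
    obtain ⟨y, hy, hyx⟩ := hL x.2
    have : y = x := Subtype.ext hyx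
    subst this
    exact hy
  · induction x with
    | zero => exact S.zero_mem
    | add x y hx hy => exact S.add_mem hx hy
    | tmul a b =>
      refine mem_of_decomposition 𝒜 (S := S.comap ((TensorProduct.mk K A Aᵐᵒᵖ).flip b))
        (fun i a ha => ?_) a
      exact mem_of_decomposition (opGrading 𝒜) (S := S.comap (TensorProduct.mk K A Aᵐᵒᵖ a))
        (fun j b hb => hS (i, j) (tmul_mem_biGrading ha hb)) b

instance biGrading.gradedAlgebra [DecidableEq G] (𝒜 : G → Submodule K A) [GradedAlgebra 𝒜] :
    GradedAlgebra (biGrading 𝒜) where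
  __ := biGrading.gradedMonoid 𝒜
  __ := biGrading.decomposition 𝒜

/-- The `G`-grading of the enveloping algebra `Aᵉ = A ⊗ Aᵒᵖ`: its piece of degree `γ` is the sum
of the `A_α ⊗ A_β` with `α + β = γ`. -/
def envGrading (𝒜 : G → Submodule K A) : G → Submodule K (A ⊗[K] Aᵐᵒᵖ) :=
  regrade (AddMonoidHom.fst G G + AddMonoidHom.snd G G) (biGrading 𝒜)

instance envGrading.gradedAlgebra [DecidableEq G] (𝒜 : G → Submodule K A) [GradedAlgebra 𝒜] :
    GradedAlgebra (envGrading 𝒜) :=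
  inferInstanceAs (GradedAlgebra (regrade _ (biGrading 𝒜)))

lemma tmul_mem_envGrading {𝒜 : G → Submodule K A} {α β γ : G} (h : α + β = γ) {a : A} {b : Aᵐᵒᵖ}
    (ha : a ∈ 𝒜 α) (hb : b ∈ opGrading 𝒜 β) : a ⊗ₜ[K] b ∈ envGrading 𝒜 γ :=
  mem_regrade _ _ (γ := (α, β)) h (tmul_mem_biGrading ha hb)

lemma envGrading_le {𝒜 : G → Submodule K A} {γ : G} {S : Submodule K (A ⊗[K] Aᵐᵒᵖ)}
    (h : ∀ α β, α + β = γ → ∀ a ∈ 𝒜 α, ∀ b ∈ opGrading 𝒜 β, a ⊗ₜ[K] b ∈ S) :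
    envGrading 𝒜 γ ≤ S :=
  regrade_le _ _ fun p hp => biGrading_le fun a ha b hb => h p.1 p.2 hp a ha b hb

end Gradings

section GradedExt

variable {K : Type*} {B : Type u} {G : Type w} [Field K] [Ring B] [Algebra K B]
  [AddCommGroup G] [DecidableEq G] {ℬ : G → Submodule K B}

namespace GrMod

/-- The shift `Σ_γ M = M(γ)`: the same module with `M(γ)_γ' = M_{γ + γ'}`. -/
def shift (γ : G) (M : GrMod.{v} ℬ) : GrMod.{v} ℬ where
  carrier := M.carrier
  gr γ' := M.gr (γ + γ')
  isInternal := isInternal_of_proj _ (fun i => M.proj (γ + i)) (fun _ _ hx => proj_same M hx)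
    (fun _ _ h _ hx => proj_ne M hx (fun h' => h (add_left_cancel h')))
    (fun S hS x => M.mem_span fun i => hS (i - γ) (by
      rw [add_sub_cancel]
      exact M.proj_mem i x))
  smul_mem := fun {i j b m} hb hm => by
    have := M.smul_mem hb hm
    rwa [add_left_comm] at this

/-- The algebra `B` as a graded left module over itself. -/
def self (ℬ : G → Submodule K B) [GradedAlgebra ℬ] : GrMod.{u} ℬ where
  carrier := B
  gr γ := (ℬ γ).toAddSubgroup
  isInternal := DirectSum.Decomposition.isInternal ℬ
  smul_mem := fun hb hm => SetLike.GradedMul.mul_mem hb hm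

/-- Right multiplication by an element `b` of degree `δ`, as a morphism of graded left modules
`Σ_γ B ⟶ Σ_{γ + δ} B`. -/
def rmul [GradedAlgebra ℬ] {γ γ' δ : G} (h : γ + δ = γ') (b : ℬ δ) :
    shift γ (self ℬ) ⟶ shift γ' (self ℬ) :=
  ofLin (M := shift γ (self ℬ)) (N := shift γ' (self ℬ))
    (LinearMap.toSpanSingleton B B (b : B) : B →ₗ[B] B) (fun i m hm => by
      have : (show B from m) * (b : B) ∈ ℬ (γ + i + δ) := SetLike.GradedMul.mul_mem hm b.2
      rw [add_right_comm, h] at this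
      exact this)

/-- The group `Ext^n(M, N)` in the abelian category of graded modules. -/
def GExt (n : ℕ) (M N : GrMod.{v} ℬ) : Type max w u (v + 1) :=
  Ext.{max w u (v + 1)} M N n

instance (n : ℕ) (M N : GrMod.{v} ℬ) : AddCommGroup (GExt n M N) :=
  inferInstanceAs (AddCommGroup (Ext.{max w u (v + 1)} M N n))

/-- The map induced on Ext groups by a morphism in the second variable. -/
def GExt.map (n : ℕ) (M : GrMod.{v} ℬ) {N N' : GrMod.{v} ℬ} (f : N ⟶ N') :
    GExt n M N →+ GExt n M N' :=
  (Ext.mk₀ f).postcomp M (add_zero n)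

lemma GExt.map_id (n : ℕ) (M N : GrMod.{v} ℬ) (x : GExt n M N) : GExt.map n M (𝟙 N) x = x :=
  Ext.comp_mk₀_id x

lemma GExt.map_comp (n : ℕ) (M : GrMod.{v} ℬ) {N N' N'' : GrMod.{v} ℬ} (f : N ⟶ N')
    (g : N' ⟶ N'') (x : GExt n M N) :
    GExt.map n M (f ≫ g) x = GExt.map n M g (GExt.map n M f x) := by
  have key (x : Ext.{max w u (v + 1)} M N n) : x.comp (Ext.mk₀ (f ≫ g)) (add_zero n) =
      (x.comp (Ext.mk₀ f) (add_zero n)).comp (Ext.mk₀ g) (add_zero n) := by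
    rw [Ext.comp_assoc_of_third_deg_zero, Ext.mk₀_comp_mk₀]
  exact key x

lemma GExt.map_add (n : ℕ) (M : GrMod.{v} ℬ) {N N' : GrMod.{v} ℬ} (f g : N ⟶ N')
    (x : GExt n M N) : GExt.map n M (f + g) x = GExt.map n M f x + GExt.map n M g x := by
  have key (x : Ext.{max w u (v + 1)} M N n) : x.comp (Ext.mk₀ (f + g)) (add_zero n) =
      x.comp (Ext.mk₀ f) (add_zero n) + x.comp (Ext.mk₀ g) (add_zero n) := by
    rw [Ext.mk₀_add, Ext.comp_add]
  exact key x

/-- The graded Ext group `⨁_γ Ext^n(M, Σ_γ N)`. -/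
abbrev uExt (n : ℕ) (M N : GrMod.{v} ℬ) : Type max w u (v + 1) :=
  ⨁ γ : G, GExt n M (shift γ N)

/-- The homogeneous piece `Ext^n(M, Σ_γ N)` of the graded Ext group. -/
def uExtGr (n : ℕ) (M N : GrMod.{v} ℬ) (γ : G) : AddSubgroup (uExt n M N) :=
  (DirectSum.of (fun γ => GExt n M (shift γ N)) γ).range

lemma uExtGr_isInternal (n : ℕ) (M N : GrMod.{v} ℬ) : DirectSum.IsInternal (uExtGr n M N) := by
  refine isInternal_of_proj _ (fun i => (DirectSum.of (fun γ => GExt n M (shift γ N)) i).comp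
    (DFinsupp.evalAddMonoidHom i)) ?_ ?_ ?_
  · rintro i _ ⟨x, rfl⟩
    exact congrArg (DirectSum.of (fun γ => GExt n M (shift γ N)) i)
      (DirectSum.of_eq_same (β := fun γ => GExt n M (shift γ N)) i x)
  · rintro i j h _ ⟨x, rfl⟩
    exact (congrArg (DirectSum.of (fun γ => GExt n M (shift γ N)) i)
      (DirectSum.of_eq_of_ne (β := fun γ => GExt n M (shift γ N)) j i x h.symm)).trans
        (map_zero (DirectSum.of (fun γ => GExt n M (shift γ N)) i))
  · intro S hS x
    induction x using DirectSum.induction_on with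
    | zero => exact S.zero_mem
    | of i x => exact hS i ⟨x, rfl⟩
    | add x y hx hy => exact S.add_mem hx hy

variable [GradedAlgebra ℬ] (n : ℕ) (M : GrMod.{u} ℬ)

/-- The action of an element `b` of degree `δ` on `uExt n M B` by right multiplication on the
second argument: it sends `x ∈ Ext^n(M, Σ_γ B)` to its image
under the map induced by `rmul b : Σ_γ B ⟶ Σ_{γ + δ} B`. -/
def uExtRightHom (δ : G) : ℬ δ →+ (uExt n M (self ℬ) →+ uExt n M (self ℬ)) :=
  AddMonoidHom.mk' (fun b => DirectSum.toAddMonoid fun γ =>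
      (DirectSum.of (fun γ => GExt n M (shift γ (self ℬ))) (γ + δ)).comp
        (GExt.map n M (rmul rfl b)))
    (fun b b' => DirectSum.addHom_ext fun γ x => by
      have : rmul (γ := γ) rfl (b + b') = rmul rfl b + rmul rfl b' :=
        hom_ext fun y => mul_add (show B from y) (b : B) (b' : B)
      rw [AddMonoidHom.add_apply]
      simp only [DirectSum.toAddMonoid_of, AddMonoidHom.comp_apply]
      rw [this, GExt.map_add, map_add])

lemma uExtRightHom_of {γ γ' δ : G} (h : γ + δ = γ') (b : ℬ δ) (x : GExt n M (shift γ (self ℬ))) :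
    uExtRightHom n M δ b (DirectSum.of (fun γ => GExt n M (shift γ (self ℬ))) γ x) =
      DirectSum.of (fun γ => GExt n M (shift γ (self ℬ))) γ'
        (GExt.map n M (rmul h b) x) := by
  subst h
  exact DirectSum.toAddMonoid_of _ _ _

/-- The right multiplication action of `B` on `uExt n M B`, extended additively from homogeneous
elements to all of `B`. -/
def uExtRight : B →+ (uExt n M (self ℬ) →+ uExt n M (self ℬ)) :=
  (DirectSum.toAddMonoid (uExtRightHom n M)).comp (DirectSum.decomposeAddEquiv ℬ).toAddMonoidHom

lemma uExtRight_of_mem {δ : G} {b : B} (hb : b ∈ ℬ δ) :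
    uExtRight n M b = uExtRightHom n M δ ⟨b, hb⟩ := by
  have : DirectSum.decomposeAddEquiv ℬ b = DirectSum.of (fun γ => ℬ γ) δ ⟨b, hb⟩ :=
    DirectSum.decompose_of_mem ℬ hb
  change DirectSum.toAddMonoid (uExtRightHom n M) (DirectSum.decomposeAddEquiv ℬ b) = _
  rw [this, DirectSum.toAddMonoid_of]

lemma uExtRight_one : uExtRight n M (1 : B) = AddMonoidHom.id _ := by
  refine DirectSum.addHom_ext fun γ x => ?_
  rw [uExtRight_of_mem n M SetLike.GradedOne.one_mem, uExtRightHom_of n M (add_zero γ)]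
  have : rmul (add_zero γ) ⟨(1 : B), SetLike.GradedOne.one_mem⟩ = 𝟙 (shift γ (self ℬ)) :=
    hom_ext fun y => mul_one (show B from y)
  rw [this, GExt.map_id]
  rfl

lemma uExtRight_mul (b b' : B) :
    uExtRight n M (b * b') = (uExtRight n M b').comp (uExtRight n M b) := by
  refine DirectSum.Decomposition.inductionOn ℬ
    (motive := fun b => uExtRight n M (b * b') = (uExtRight n M b').comp (uExtRight n M b))
    ?_ ?_ ?_ b
  · simp
  · intro δ b
    refine DirectSum.Decomposition.inductionOn ℬ
      (motive := fun b' => uExtRight n M ((b : B) * b') =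
        (uExtRight n M b').comp (uExtRight n M (b : B))) ?_ ?_ ?_ b'
    · simp
    · intro δ' b'
      have hm : (b : B) * (b' : B) ∈ ℬ (δ + δ') := SetLike.GradedMul.mul_mem b.2 b'.2
      refine DirectSum.addHom_ext fun γ x => ?_
      have hr : rmul (add_assoc γ δ δ').symm ⟨_, hm⟩ =
          (rmul rfl b : shift γ (self ℬ) ⟶ _) ≫ rmul rfl b' :=
        hom_ext fun y => (mul_assoc (show B from y) (b : B) (b' : B)).symm
      rw [AddMonoidHom.comp_apply, uExtRight_of_mem n M hm, uExtRight_of_mem n M b.2,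
        uExtRight_of_mem n M b'.2, uExtRightHom_of n M (add_assoc γ δ δ').symm,
        uExtRightHom_of n M rfl, uExtRightHom_of n M rfl, hr, GExt.map_comp]
    · intro c d hc hd
      rw [mul_add, map_add, map_add, hc, hd, AddMonoidHom.add_comp]
  · intro c d hc hd
    rw [add_mul, map_add, map_add, hc, hd, AddMonoidHom.comp_add]

lemma uExtRight_mem {δ γ γ' : G} (h : γ + δ = γ') {b : B} (hb : b ∈ ℬ δ)
    {x : uExt n M (self ℬ)} (hx : x ∈ uExtGr n M (self ℬ) γ) :
    uExtRight n M b x ∈ uExtGr n M (self ℬ) γ' := by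
  obtain ⟨x, rfl⟩ := hx
  rw [uExtRight_of_mem n M hb, uExtRightHom_of n M h]
  exact ⟨_, rfl⟩

end GrMod

end GradedExt

section Bimodules

variable {K : Type*} {A : Type u} {G : Type w} [Field K] [Ring A] [Algebra K A]
  [AddCommGroup G]

/-- The group `Aut_G(A)` of algebra automorphisms that preserve degrees. -/
def gradedAut (𝒜 : G → Submodule K A) : Subgroup (A ≃ₐ[K] A) where
  carrier := {μ | ∀ γ a, μ a ∈ 𝒜 γ ↔ a ∈ 𝒜 γ}
  one_mem' := fun _ _ => Iff.rfl
  mul_mem' := fun {μ ν} hμ hν γ a => (hμ γ (ν a)).trans (hν γ a)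
  inv_mem' := fun {μ} hμ γ a => by
    rw [← hμ γ (μ⁻¹ a)]
    exact iff_of_eq (congrArg (· ∈ 𝒜 γ) (μ.apply_symm_apply a))

/-- A degree preserving automorphism of `A` preserves the degrees of the regraded algebra. -/
def gradedAut.regrade {H : Type*} [AddCommGroup H] (φ : G →+ H) {𝒜 : G → Submodule K A}
    (μ : gradedAut 𝒜) : gradedAut (SkewCY.regrade φ 𝒜) :=
  ⟨μ, by
    have h : ∀ (ν : gradedAut 𝒜) (δ : H), SkewCY.regrade φ 𝒜 δ ≤
        (SkewCY.regrade φ 𝒜 δ).comap (ν : A ≃ₐ[K] A).toAlgHom.toLinearMap := fun ν δ =>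
      regrade_le φ 𝒜 fun γ hγ a ha => mem_regrade φ 𝒜 hγ ((ν.2 γ a).2 ha)
    intro δ a
    refine ⟨fun ha => ?_, fun ha => h μ δ ha⟩
    have := h μ⁻¹ δ ha
    have e : (μ : A ≃ₐ[K] A).symm ((μ : A ≃ₐ[K] A) a) = a := AlgEquiv.symm_apply_apply _ a
    rw [← e]
    exact this⟩

/-- The anti-automorphism `a ⊗ b ↦ b ⊗ a` of `Aᵉ = A ⊗ Aᵒᵖ`. -/
def envAnti (K A : Type*) [Field K] [Ring A] [Algebra K A] :
    (A ⊗[K] Aᵐᵒᵖ) →ₐ[K] (A ⊗[K] Aᵐᵒᵖ)ᵐᵒᵖ :=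
  ((Algebra.TensorProduct.opAlgEquiv K K A Aᵐᵒᵖ).toAlgHom.comp
    (Algebra.TensorProduct.map (AlgHom.id K Aᵐᵒᵖ) (AlgEquiv.opOp K A).toAlgHom)).comp
      (Algebra.TensorProduct.comm K A Aᵐᵒᵖ).toAlgHom

lemma envAnti_tmul (a b : A) :
    envAnti K A (a ⊗ₜ MulOpposite.op b) = MulOpposite.op (b ⊗ₜ MulOpposite.op a) := by
  simp [envAnti]

lemma envAnti_mem {𝒜 : G → Submodule K A} {γ : G} {t : A ⊗[K] Aᵐᵒᵖ} (ht : t ∈ envGrading 𝒜 γ) :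
    (envAnti K A t).unop ∈ envGrading 𝒜 γ := by
  have : envGrading 𝒜 γ ≤ (envGrading 𝒜 γ).comap
      ((MulOpposite.opLinearEquiv K).symm.toLinearMap ∘ₗ (envAnti K A).toLinearMap) := by
    refine envGrading_le fun α β h a ha b hb => ?_
    induction b using MulOpposite.rec' with | h b => ?_
    rw [Submodule.mem_comap]
    change (envAnti K A (a ⊗ₜ MulOpposite.op b)).unop ∈ _
    rw [envAnti_tmul]
    exact tmul_mem_envGrading ((add_comm β α).trans h) hb ha
  exact this ht

/-- The ring homomorphism `μ ⊗ ν` of `Aᵉ`. -/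
def twistHom {𝒜 : G → Submodule K A} (μ ν : gradedAut 𝒜) : (A ⊗[K] Aᵐᵒᵖ) →ₐ[K] (A ⊗[K] Aᵐᵒᵖ) :=
  Algebra.TensorProduct.map (μ : A ≃ₐ[K] A).toAlgHom (AlgHom.op (ν : A ≃ₐ[K] A).toAlgHom)

lemma twistHom_mem {𝒜 : G → Submodule K A} (μ ν : gradedAut 𝒜) {γ : G} {t : A ⊗[K] Aᵐᵒᵖ} (ht : t ∈ envGrading 𝒜 γ) :
    twistHom μ ν t ∈ envGrading 𝒜 γ := by
  have : envGrading 𝒜 γ ≤ (envGrading 𝒜 γ).comap (twistHom μ ν).toLinearMap :=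
    envGrading_le fun α β h a ha b hb =>
      tmul_mem_envGrading h ((μ.2 α a).2 ha) ((ν.2 β b.unop).2 hb)
  exact this ht

namespace GrMod

variable [DecidableEq G] (𝒜 : G → Submodule K A)

/-- The algebra `A` as a graded bimodule over itself, that is, as a graded `Aᵉ`-module with
`(a ⊗ b) • x = a * x * b`. -/
def diagonal [GradedAlgebra 𝒜] : GrMod.{u} (envGrading 𝒜) where
  carrier := A
  module := Module.compHom A (AlgHom.mulLeftRight K A).toRingHom
  gr γ := (𝒜 γ).toAddSubgroup
  isInternal := DirectSum.Decomposition.isInternal 𝒜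
  smul_mem := fun {i j t m} ht hm => by
    have : envGrading 𝒜 i ≤ (𝒜 (i + j)).comap
        ((AlgHom.mulLeftRight K A).toLinearMap.flip m) := by
      refine envGrading_le fun α β h a ha b hb => ?_
      change AlgHom.mulLeftRight K A (a ⊗ₜ b) m ∈ 𝒜 (i + j)
      rw [AlgHom.mulLeftRight_apply, ← h, add_right_comm]
      exact SetLike.GradedMul.mul_mem (SetLike.GradedMul.mul_mem ha hm) hb
    exact this ht

variable {𝒜} in
/-- The twisted bimodule `^μ M ^ν`: the same graded vector space with the actions
`a * m = μ(a) • m` and `m * a = m • ν(a)`. -/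
def twist (μ ν : gradedAut 𝒜) (M : GrMod.{v} (envGrading 𝒜)) : GrMod.{v} (envGrading 𝒜) where
  carrier := M.carrier
  module := Module.compHom M.carrier (twistHom μ ν).toRingHom
  gr := M.gr
  isInternal := M.isInternal
  smul_mem := fun ht hm => M.smul_mem (twistHom_mem μ ν ht) hm

/-- The graded bimodule `uExt^n_{Aᵉ}(A, Aᵉ)`, as a graded `Aᵉ`-module.  The bimodule structure comes
from the right multiplication of `Aᵉ` on its second argument: `a ⊗ b` acts as the right
multiplication by `b ⊗ a`. -/
def extBimodule [GradedAlgebra 𝒜] (n : ℕ) : GrMod.{max w (u + 1)} (envGrading 𝒜) where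
  carrier := uExt n (diagonal 𝒜) (self (envGrading 𝒜))
  module :=
    { smul := fun t x => uExtRight n (diagonal 𝒜) (envAnti K A t).unop x
      one_smul := fun x => by
        change uExtRight n (diagonal 𝒜) (envAnti K A 1).unop x = x
        rw [map_one, MulOpposite.unop_one, uExtRight_one]
        rfl
      mul_smul := fun s t x => by
        change uExtRight n (diagonal 𝒜) (envAnti K A (s * t)).unop x = _
        rw [map_mul, MulOpposite.unop_mul, uExtRight_mul]
        rfl
      smul_zero := fun t => map_zero (uExtRight n (diagonal 𝒜) (envAnti K A t).unop)
      smul_add := fun t => map_add (uExtRight n (diagonal 𝒜) (envAnti K A t).unop)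
      add_smul := fun s t x => by
        change uExtRight n (diagonal 𝒜) (envAnti K A (s + t)).unop x = _
        rw [map_add, MulOpposite.unop_add, map_add]
        rfl
      zero_smul := fun x => by
        change uExtRight n (diagonal 𝒜) (envAnti K A 0).unop x = _
        rw [map_zero, MulOpposite.unop_zero, map_zero]
        rfl }
  gr := uExtGr n (diagonal 𝒜) (self (envGrading 𝒜))
  isInternal := uExtGr_isInternal n _ _
  smul_mem := fun {i j _ _} ht hm =>
    uExtRight_mem n (diagonal 𝒜) (add_comm j i) (envAnti_mem ht) hm

/-- Two graded modules, possibly in different universes, are isomorphic: there is a `B`-linear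
bijection that identifies the homogeneous pieces. -/
def IsGradedIso {B : Type*} [Ring B] [Algebra K B] {ℬ : G → Submodule K B} (M : GrMod.{v₁} ℬ)
    (N : GrMod.{v₂} ℬ) : Prop :=
  ∃ e : M.carrier ≃ₗ[B] N.carrier, ∀ γ x, e x ∈ N.gr γ ↔ x ∈ M.gr γ

end GrMod

open GrMod

variable [DecidableEq G] (𝒜 : G → Submodule K A) [GradedAlgebra 𝒜]

/-- `A` is homologically `G`-smooth: it has a bounded projective resolution by finitely generated
objects in the category of `G`-graded `Aᵉ`-modules. -/
def HomologicallySmooth : Prop :=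
  ∃ P : ProjectiveResolution (diagonal 𝒜),
    (∃ n : ℕ, ∀ i ≥ n, IsZero (P.complex.X i)) ∧
      ∀ i, Module.Finite (A ⊗[K] Aᵐᵒᵖ) (P.complex.X i).carrier

/-- `μ` is a Nakayama automorphism of `A` and `l` is a corresponding Gorenstein parameter, in
dimension `d`: the graded bimodule `uExt^i_{Aᵉ}(A, Aᵉ)` is zero for `i ≠ d` and isomorphic to
`Σ_l ¹A^μ` for `i = d`. -/
def IsNakayama (d : ℕ) (μ : gradedAut 𝒜) (l : G) : Prop :=
  (∀ i, i ≠ d → Subsingleton (extBimodule 𝒜 i).carrier) ∧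
    IsGradedIso (extBimodule 𝒜 d) (shift l (twist 1 μ (diagonal 𝒜)))

/-- `A` is skew `G`-Calabi-Yau of dimension `d`. -/
def IsSkewCalabiYau (d : ℕ) : Prop :=
  HomologicallySmooth 𝒜 ∧ ∃ (μ : gradedAut 𝒜) (l : G), IsNakayama 𝒜 d μ l

end Bimodules

end SkewCY

end

noncomputable section

namespace SkewCY

set_option linter.unusedSectionVars false

universe v v₁ v₂ u w w'

namespace GrMod

section Basics

variable {K : Type*} {B : Type u} {G : Type w} [Field K] [Ring B] [Algebra K B]
  [AddCommGroup G] [DecidableEq G] {ℬ : G → Submodule K B}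

/-- The additive map on a graded module assembled from additive maps on the homogeneous pieces. -/
def descAddHom (M : GrMod.{v} ℬ) {X : Type*} [AddCommMonoid X] (f : ∀ i, M.gr i →+ X) :
    M.carrier →+ X :=
  letI := M.isInternal.chooseDecomposition
  (DirectSum.toAddMonoid f).comp (DirectSum.decomposeAddEquiv M.gr).toAddMonoidHom

lemma descAddHom_of_mem (M : GrMod.{v} ℬ) {X : Type*} [AddCommMonoid X] (f : ∀ i, M.gr i →+ X)
    {i : G} {x : M.carrier} (hx : x ∈ M.gr i) : M.descAddHom f x = f i ⟨x, hx⟩ := by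
  let _ := M.isInternal.chooseDecomposition
  have : DirectSum.decomposeAddEquiv M.gr x = DirectSum.of (fun i => M.gr i) i ⟨x, hx⟩ :=
    DirectSum.decompose_of_mem M.gr hx
  change DirectSum.toAddMonoid f (DirectSum.decomposeAddEquiv M.gr x) = _
  rw [this, DirectSum.toAddMonoid_of]

lemma ext_proj (M : GrMod.{v} ℬ) {x y : M.carrier} (h : ∀ i, M.proj i x = M.proj i y) :
    x = y := by
  have : x - y ∈ (⊥ : AddSubgroup M.carrier) := M.mem_span fun i => by simp [h]
  exact sub_eq_zero.1 this

lemma proj_smul [GradedAlgebra ℬ] (M : GrMod.{v} ℬ) {k : G} {b : B} (hb : b ∈ ℬ k) (i : G)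
    (x : M.carrier) : M.proj (k + i) (b • x) = b • M.proj i x := by
  refine M.induction (p := fun x => M.proj (k + i) (b • x) = b • M.proj i x) x (by simp) ?_
    (fun x y hx hy => by simp [hx, hy])
  intro j x hx
  by_cases h : j = i
  · subst h
    rw [proj_same M (M.smul_mem hb hx), proj_same M hx]
  · rw [proj_ne M (M.smul_mem hb hx) (fun h' => h (add_left_cancel h')), proj_ne M hx h, smul_zero]

lemma exists_finset_proj_eq_zero (M : GrMod.{v} ℬ) (x : M.carrier) :
    ∃ T : Finset G, ∀ i ∉ T, M.proj i x = 0 := by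
  refine M.induction (p := fun x => ∃ T : Finset G, ∀ i ∉ T, M.proj i x = 0) x
    ⟨∅, by simp⟩ ?_ ?_
  · exact fun i x hx => ⟨{i}, fun j hj => proj_ne M hx fun h => hj (by simp [h])⟩
  · rintro x y ⟨S, hS⟩ ⟨T, hT⟩
    refine ⟨S ∪ T, fun i hi => ?_⟩
    rw [Finset.notMem_union] at hi
    rw [map_add, hS i hi.1, hT i hi.2, add_zero]

/-- An additive map out of a graded module that commutes with the homogeneous scalars is linear. -/
lemma smul_of_homogeneous [GradedAlgebra ℬ] {M : Type*} [AddCommGroup M] [Module B M]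
    {N : Type*} [AddCommGroup N] [Module B N] (f : M →+ N)
    (hf : ∀ k, ∀ b ∈ ℬ k, ∀ m, f (b • m) = b • f m) (b : B) (m : M) : f (b • m) = b • f m :=
  DirectSum.Decomposition.inductionOn ℬ (motive := fun b : B => f (b • m) = b • f m) (by simp)
    (fun b => hf _ b b.2 m) (fun b c hb hc => by rw [add_smul, map_add, hb, hc, add_smul]) b

lemma mono_of_injective {M N : GrMod.{v} ℬ} (f : M ⟶ N) (hf : Function.Injective (lin f)) :
    Mono f :=
  ⟨fun _ _ h => hom_ext fun x => hf (congrArg (fun k => lin k x) h)⟩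

lemma epi_of_surjective {M N : GrMod.{v} ℬ} (f : M ⟶ N) (hf : Function.Surjective (lin f)) :
    Epi f :=
  ⟨fun g h e => hom_ext fun y => by
    obtain ⟨x, rfl⟩ := hf y
    exact congrArg (fun k => lin k x) e⟩

lemma exact_iff (S : ShortComplex (GrMod.{v} ℬ)) :
    S.Exact ↔ Function.Exact (lin S.f) (lin S.g) := by
  rw [S.exact_iff_of_forks (kerForkIsLimit S.g) (cokerCoforkIsColimit S.f)]
  constructor
  · refine fun h y => ⟨fun hy => ?_, ?_⟩
    · exact (Submodule.Quotient.mk_eq_zero _).1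
        (congrArg (fun k : ker S.g ⟶ coker S.f => lin k ⟨y, hy⟩) h)
    · rintro ⟨x, rfl⟩
      exact congrArg (fun k => lin k x) S.zero
  · exact fun h => hom_ext fun x => (Submodule.Quotient.mk_eq_zero _).2 ((h x.1).1 x.2)

lemma shortExact_iff (S : ShortComplex (GrMod.{v} ℬ)) :
    S.ShortExact ↔ Function.Injective (lin S.f) ∧ Function.Exact (lin S.f) (lin S.g) ∧
      Function.Surjective (lin S.g) := by
  constructor
  · intro h
    have := h.mono_f
    have := h.epi_g
    exact ⟨injective_of_mono _, (exact_iff S).1 h.exact, surjective_of_epi _⟩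
  · rintro ⟨h₁, h₂, h₃⟩
    exact { exact := (exact_iff S).2 h₂
            mono_f := mono_of_injective _ h₁
            epi_g := epi_of_surjective _ h₃ }

/-- The graded free module on a family of generators with prescribed degrees. -/
def free (ℬ : G → Submodule K B) [GradedAlgebra ℬ] {I : Type v} (deg : I → G) :
    GrMod.{max u v} ℬ where
  carrier := I →₀ B
  gr i :=
    { carrier := {f | ∀ s, f s ∈ ℬ (i - deg s)}
      zero_mem' := fun s => (ℬ _).zero_mem
      add_mem' := fun hf hg s => (ℬ _).add_mem (hf s) (hg s)
      neg_mem' := fun hf s => (ℬ _).neg_mem (hf s) }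
  isInternal := by
    refine isInternal_of_proj _ (fun i => Finsupp.liftAddHom fun s =>
      (Finsupp.singleAddHom s).comp ((self ℬ).proj (i - deg s))) ?_ ?_ ?_
    · intro i f hf
      rw [Finsupp.liftAddHom_apply]
      refine (Finsupp.sum_congr fun s _ => ?_).trans (Finsupp.sum_single f)
      exact congrArg (Finsupp.single s) (proj_same (self ℬ) (hf s))
    · intro i j h f hf
      rw [Finsupp.liftAddHom_apply]
      refine Finset.sum_eq_zero fun s _ => ?_
      refine (congrArg (Finsupp.single s) (proj_ne (self ℬ) (hf s) ?_)).trans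
        (Finsupp.single_zero s)
      exact fun h' => h (sub_left_injective h')
    · intro S hS f
      induction f using Finsupp.induction_linear with
      | zero => exact S.zero_mem
      | add f g hf hg => exact S.add_mem hf hg
      | single s b =>
        suffices h : ∀ i, ∀ b ∈ ℬ i, (Finsupp.single s b : I →₀ B) ∈ S from
          (self ℬ).mem_span (S := S.comap (Finsupp.singleAddHom s)) (x := b) fun i =>
            h i _ ((self ℬ).proj_mem i b)
        refine fun i b hb => hS (i + deg s) fun t => ?_
        by_cases h : s = t
        · subst h
          rwa [Finsupp.single_eq_same, add_sub_cancel_right]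
        · rw [Finsupp.single_eq_of_ne (Ne.symm h)]
          exact (ℬ _).zero_mem
  smul_mem := fun {i j b m} hb hm s => by
    rw [add_sub_assoc]
    exact SetLike.GradedMul.mul_mem hb (hm s)

lemma linearCombination_mem [GradedAlgebra ℬ] {I : Type v₁} {deg : I → G} {N : Type*}
    [AddCommGroup N] [Module B N] {S : AddSubgroup N} {x : I → N} {i : G}
    (hx : ∀ s, ∀ b ∈ ℬ (i - deg s), b • x s ∈ S) {f : I →₀ B} (hf : f ∈ (free ℬ deg).gr i) :
    Finsupp.linearCombination B x f ∈ S := by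
  rw [Finsupp.linearCombination_apply]
  exact S.sum_mem fun s _ => hx s _ (hf s)

end Basics

section Regrade

variable {K : Type*} {B : Type u} {G : Type w} {H : Type w'} [Field K] [Ring B] [Algebra K B]
  [AddCommGroup G] [DecidableEq G] [AddCommGroup H] [DecidableEq H]
  {ℬ : G → Submodule K B} {ℬ' : H → Submodule K B} {φ : G →+ H}

/-- The pieces of a regraded module. -/
def regradeGr (φ : G →+ H) (M : GrMod.{v} ℬ) (δ : H) : AddSubgroup M.carrier :=
  ⨆ (γ : G) (_ : φ γ = δ), M.gr γ

lemma mem_regradeGr (φ : G →+ H) (M : GrMod.{v} ℬ) {γ : G} {δ : H} (h : φ γ = δ) {x : M.carrier}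
    (hx : x ∈ M.gr γ) : x ∈ regradeGr φ M δ :=
  AddSubgroup.mem_iSup_of_mem γ (AddSubgroup.mem_iSup_of_mem h hx)

lemma regradeGr_le (φ : G →+ H) (M : GrMod.{v} ℬ) {δ : H} {S : AddSubgroup M.carrier}
    (h : ∀ γ, φ γ = δ → M.gr γ ≤ S) : regradeGr φ M δ ≤ S :=
  iSup_le fun γ => iSup_le fun hγ => h γ hγ

lemma _root_.SkewCY.regrade_le_addSubgroup (φ : G →+ H) (ℬ : G → Submodule K B) {δ : H}
    {S : AddSubgroup B} (h : ∀ γ, φ γ = δ → (ℬ γ).toAddSubgroup ≤ S) :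
    (regrade φ ℬ δ).toAddSubgroup ≤ S := by
  intro b hb
  have hb : b ∈ ⨆ i : {γ // φ γ = δ}, ℬ i.1 := by
    rw [iSup_subtype]
    exact hb
  exact Submodule.iSup_induction _ (motive := fun b => b ∈ S) hb (fun i x hx => h i.1 i.2 hx)
    S.zero_mem (fun _ _ => S.add_mem)

/-- The regrading of a graded module along a group homomorphism. -/
def regradeObj (hℬ : ℬ' = regrade φ ℬ) (M : GrMod.{v} ℬ) : GrMod.{v} ℬ' where
  carrier := M.carrier
  gr := regradeGr φ M
  isInternal := by
    let p : H → M.carrier →+ M.carrier := fun δ =>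
      M.descAddHom fun γ => if φ γ = δ then (M.gr γ).subtype else 0
    have hp : ∀ δ γ x, x ∈ M.gr γ → p δ x = if φ γ = δ then x else 0 := by
      intro δ γ x hx
      simp only [p, M.descAddHom_of_mem _ hx]
      split_ifs <;> rfl
    refine isInternal_of_proj _ p (fun δ x hx => ?_) (fun δ ε h x hx => ?_) (fun S hS x => ?_)
    · exact regradeGr_le φ M (S := (p δ).eqLocus (AddMonoidHom.id _))
        (fun γ hγ x hx => (hp δ γ x hx).trans (if_pos hγ)) hx
    · exact regradeGr_le φ M (S := (p δ).ker)
        (fun γ hγ x hx => (hp δ γ x hx).trans (if_neg (hγ.symm ▸ h))) hx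
    · exact M.mem_span fun γ => hS (φ γ) (mem_regradeGr φ M rfl (M.proj_mem γ x))
  smul_mem := by
    subst hℬ
    intro i j b m hb hm
    refine regrade_le_addSubgroup φ ℬ (S := (regradeGr φ M (i + j)).comap
      ((smulAddHom B M.carrier).flip m)) (fun γ hγ b hb => ?_) hb
    refine regradeGr_le φ M (S := (regradeGr φ M (i + j)).comap
      (smulAddHom B M.carrier b)) (fun γ' hγ' m hm => ?_) hm
    exact mem_regradeGr φ M (by rw [map_add, hγ, hγ']) (M.smul_mem hb hm)

/-- A linear map that sends the piece of degree `γ` into the piece of degree `φ γ` is a morphism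
from the regraded module. -/
def regradeDesc (hℬ : ℬ' = regrade φ ℬ) {M : GrMod.{v} ℬ} {N : GrMod.{v} ℬ'}
    (f : M.carrier →ₗ[B] N.carrier) (hf : ∀ γ, ∀ m ∈ M.gr γ, f m ∈ N.gr (φ γ)) :
    regradeObj hℬ M ⟶ N :=
  ofLin (M := regradeObj hℬ M) f fun δ _ hx =>
    regradeGr_le φ M (S := (N.gr δ).comap f.toAddMonoidHom)
      (fun γ (hγ : φ γ = δ) m (hm : m ∈ M.gr γ) => show f m ∈ N.gr δ from hγ ▸ hf γ m hm) hx

/-- The regrading functor. -/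
def regradeFunctor (hℬ : ℬ' = regrade φ ℬ) : GrMod.{v} ℬ ⥤ GrMod.{v} ℬ' where
  obj := regradeObj hℬ
  map {M N} f := regradeDesc hℬ (N := regradeObj hℬ N) (lin f)
    fun _ _ hm => mem_regradeGr φ N rfl (lin_mem f hm)

variable (hℬ : ℬ' = regrade φ ℬ)

instance : (regradeFunctor.{v} hℬ).Additive where

instance : (regradeFunctor.{v} hℬ).PreservesHomology :=
  Functor.preservesHomology_of_map_exact _ fun S hS =>
    (exact_iff (S.map (regradeFunctor hℬ))).2 ((exact_iff S).1 hS)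

instance : PreservesFiniteLimits (regradeFunctor.{v} hℬ) :=
  Functor.preservesFiniteLimits_of_preservesHomology _

instance : PreservesFiniteColimits (regradeFunctor.{v} hℬ) :=
  Functor.preservesFiniteColimits_of_preservesHomology _

instance [GradedAlgebra ℬ] [GradedAlgebra ℬ'] :
    (regradeFunctor.{u} hℬ).PreservesProjectiveObjects where
  projective_obj {P} hP := by
    let I := {x : P.carrier // ∃ i, x ∈ P.gr i}
    let deg : I → G := fun s => s.2.choose
    have hdeg : ∀ s : I, s.1 ∈ P.gr (deg s) := fun s => s.2.choose_spec
    let π : free ℬ deg ⟶ P := ofLin (M := free ℬ deg)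
      (Finsupp.linearCombination B (fun s : I => s.1)) fun i _ hm =>
        linearCombination_mem (fun s b hb => by
          have := P.smul_mem hb (hdeg s)
          rwa [sub_add_cancel] at this) hm
    have hπ : ∀ s : I, lin π (Finsupp.single s 1 : I →₀ B) = s.1 := fun s =>
      (Finsupp.linearCombination_single B (1 : B) s).trans (one_smul _ _)
    have : Epi π := epi_of_surjective π fun x =>
      P.induction (p := fun x => ∃ y, lin π y = x) x ⟨0, map_zero _⟩
        (fun i x hx => ⟨_, hπ ⟨x, i, hx⟩⟩)
        (by
          rintro _ _ ⟨x, rfl⟩ ⟨y, rfl⟩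
          exact ⟨x + y, map_add _ _ _⟩)
    let σ : P ⟶ free ℬ deg := Projective.factorThru (𝟙 P) π
    have hσ : ∀ x, lin π (lin σ x) = x := fun x =>
      congrArg (fun k => lin k x) (Projective.factorThru_comp (𝟙 P) π)
    refine ⟨fun {Y X} f e he => ?_⟩
    have hsurj := surjective_of_epi e
    have hlift : ∀ s : I, ∃ x ∈ Y.gr (φ (deg s)), lin e x = lin f s.1 := by
      intro s
      obtain ⟨x, hx⟩ := hsurj (lin f s.1)
      refine ⟨Y.proj (φ (deg s)) x, Y.proj_mem _ _, ?_⟩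
      rw [lin_proj, hx]
      exact proj_same X (lin_mem f (mem_regradeGr φ P rfl (hdeg s)))
    choose y hy hye using hlift
    let g : (regradeObj hℬ (free ℬ deg)) ⟶ Y := regradeDesc hℬ (M := free ℬ deg)
      (Finsupp.linearCombination B y) fun γ _ hm =>
        linearCombination_mem (fun s b hb => by
          have hs : b ∈ ℬ' (φ (γ - deg s)) := by
            subst hℬ
            exact mem_regrade φ ℬ rfl hb
          have := Y.smul_mem hs (hy s)
          rwa [← map_add, sub_add_cancel] at this) hm
    let f' : P.carrier →ₗ[B] X.carrier := lin f
    have hg : lin e ∘ₗ Finsupp.linearCombination B y =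
        f' ∘ₗ Finsupp.linearCombination B (fun s : I => s.1) := Finsupp.lhom_ext fun s b => by
      rw [LinearMap.comp_apply, LinearMap.comp_apply, Finsupp.linearCombination_single,
        Finsupp.linearCombination_single, map_smul, hye, map_smul]
      rfl
    refine ⟨(regradeFunctor hℬ).map σ ≫ g, hom_ext fun x => ?_⟩
    exact (LinearMap.congr_fun hg (lin σ x)).trans (congrArg f' (hσ x))

end Regrade

end GrMod

namespace GrMod

section HomComponents

variable {K : Type*} {B : Type u} {G : Type w} [Field K] [Ring B] [Algebra K B]
  [AddCommGroup G] [DecidableEq G] {ℬ : G → Submodule K B} [GradedAlgebra ℬ]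

/-- The component of degree `γ` of a linear map between graded modules. -/
def homComponent {M N : GrMod.{v} ℬ} (f : M.carrier →ₗ[B] N.carrier) (γ : G) : M ⟶ shift γ N :=
  let c : M.carrier →+ N.carrier := M.descAddHom fun i =>
    (N.proj (γ + i)).comp (f.toAddMonoidHom.comp (M.gr i).subtype)
  have hc : ∀ i m, m ∈ M.gr i → c m = N.proj (γ + i) (f m) := fun i m hm =>
    M.descAddHom_of_mem _ hm
  ofLin (N := shift γ N)
    { c with
      map_smul' := smul_of_homogeneous (ℬ := ℬ) c fun k b hb m => by
        refine M.induction (p := fun m => c (b • m) = b • c m) m (by simp) ?_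
          (fun x y hx hy => by rw [smul_add, map_add, map_add, hx, hy, smul_add])
        intro i m hm
        rw [hc _ _ (M.smul_mem hb hm), hc _ _ hm, map_smul, add_left_comm, proj_smul N hb] }
    fun i m hm => (hc i m hm).symm ▸ N.proj_mem (γ + i) (f m)

lemma lin_homComponent {M N : GrMod.{v} ℬ} (f : M.carrier →ₗ[B] N.carrier) (γ : G) {i : G}
    {m : M.carrier} (hm : m ∈ M.gr i) : lin (homComponent f γ) m = N.proj (γ + i) (f m) :=
  M.descAddHom_of_mem _ hm

lemma exists_finset_homComponent_eq_zero {M N : GrMod.{v} ℬ} [Module.Finite B M.carrier]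
    (f : M.carrier →ₗ[B] N.carrier) : ∃ T : Finset G, ∀ γ ∉ T, homComponent f γ = 0 := by
  have key : ∀ m, ∃ T : Finset G, ∀ γ ∉ T, lin (homComponent f γ) m = 0 := by
    intro m
    refine M.induction (p := fun m => ∃ T : Finset G, ∀ γ ∉ T, lin (homComponent f γ) m = 0) m
      ⟨∅, fun _ _ => map_zero _⟩ ?_ ?_
    · intro i m hm
      obtain ⟨T, hT⟩ := N.exists_finset_proj_eq_zero (f m)
      refine ⟨T.image (· - i), fun γ hγ => ?_⟩
      rw [lin_homComponent f γ hm]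
      exact hT _ fun h => hγ (Finset.mem_image.2 ⟨_, h, add_sub_cancel_right _ _⟩)
    · rintro x y ⟨S, hS⟩ ⟨T, hT⟩
      refine ⟨S ∪ T, fun i hi => ?_⟩
      rw [Finset.notMem_union] at hi
      rw [map_add, hS i hi.1, hT i hi.2]
      exact add_zero _
  choose T hT using key
  obtain ⟨s, hs⟩ := Module.Finite.fg_top (R := B) (M := M.carrier)
  refine ⟨s.biUnion T, fun γ hγ => Subtype.ext ?_⟩
  refine LinearMap.ext_on hs fun m hm => hT m γ fun h => hγ ?_
  exact Finset.mem_biUnion.2 ⟨m, hm, h⟩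

/-- `Ext⁰` is the group of morphisms. -/
def GExt.addEquiv₀ (M N : GrMod.{v} ℬ) : GExt 0 M N ≃+ (M ⟶ N) := Ext.addEquiv₀

/-- The linear map underlying an element of the graded Hom group. -/
def uExtZeroToLin (M N : GrMod.{v} ℬ) : uExt 0 M N →+ (M.carrier →ₗ[B] N.carrier) :=
  DirectSum.toAddMonoid fun γ =>
    (AddMonoidHom.mk' (fun f : M ⟶ shift γ N => (lin (N := shift γ N) f : M.carrier →ₗ[B] N.carrier))
      fun _ _ => rfl).comp
      (GExt.addEquiv₀ M (shift γ N)).toAddMonoidHom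

lemma uExtZeroToLin_of (M N : GrMod.{v} ℬ) (γ : G) (f : GExt 0 M (shift γ N)) :
    uExtZeroToLin M N (DirectSum.of (fun γ => GExt 0 M (shift γ N)) γ f) =
      lin (GExt.addEquiv₀ _ _ f) :=
  DirectSum.toAddMonoid_of _ _ _

lemma proj_uExtZeroToLin (M N : GrMod.{v} ℬ) (x : uExt 0 M N) (γ i : G) {m : M.carrier}
    (hm : m ∈ M.gr i) :
    N.proj (γ + i) (uExtZeroToLin M N x m) = lin (GExt.addEquiv₀ _ _ (x γ)) m := by
  induction x using DirectSum.induction_on with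
  | zero =>
    rw [map_zero, DirectSum.zero_apply]
    exact (map_zero _).trans
      (congrArg (fun f => lin f m) (map_zero (GExt.addEquiv₀ M (shift γ N)))).symm
  | add x y hx hy =>
    rw [map_add, LinearMap.add_apply, map_add, hx, hy, DirectSum.add_apply]
    exact (congrArg (fun f => lin f m)
      (map_add (GExt.addEquiv₀ M (shift γ N)) (x γ) (y γ))).symm
  | of γ' f =>
    rw [uExtZeroToLin_of]
    have hmem : lin (GExt.addEquiv₀ _ _ f) m ∈ N.gr (γ' + i) := lin_mem (GExt.addEquiv₀ _ _ f) hm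
    by_cases h : γ' = γ
    · subst h
      rw [DirectSum.of_eq_same]
      exact proj_same N hmem
    · rw [DirectSum.of_eq_of_ne _ _ _ (Ne.symm h)]
      refine (proj_ne N hmem fun h' => h (add_right_cancel h')).trans ?_
      exact (congrArg (fun f => lin f m) (map_zero (GExt.addEquiv₀ M (shift γ N)))).symm

lemma uExtZeroToLin_injective (M N : GrMod.{v} ℬ) : Function.Injective (uExtZeroToLin M N) := by
  rw [injective_iff_map_eq_zero]
  refine fun x hx => DirectSum.ext fun γ => (GExt.addEquiv₀ _ _).injective (hom_ext fun m => ?_)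
  have h0 : lin (GExt.addEquiv₀ _ _ (x γ)) = 0 := LinearMap.ext fun m =>
    M.induction (p := fun m => lin (GExt.addEquiv₀ _ _ (x γ)) m = 0) m (map_zero _)
      (fun i m hm => by
        rw [← proj_uExtZeroToLin M N x γ i hm, hx, LinearMap.zero_apply]
        exact map_zero _)
      (fun x y hx hy => by
        rw [map_add, hx, hy]
        exact add_zero _)
  rw [h0]
  exact (congrArg (fun f => lin f m) (map_zero (GExt.addEquiv₀ M (shift γ N)))).symm

lemma uExtZeroToLin_surjective (M N : GrMod.{v} ℬ) [Module.Finite B M.carrier] :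
    Function.Surjective (uExtZeroToLin M N) := by
  intro f
  obtain ⟨T, hT⟩ := exists_finset_homComponent_eq_zero f
  let x : uExt 0 M N := DirectSum.mk (fun γ => GExt 0 M (shift γ N)) T fun γ =>
    (GExt.addEquiv₀ _ _).symm (homComponent f γ)
  have hx : ∀ γ, GExt.addEquiv₀ _ _ (x γ) = homComponent f γ := by
    intro γ
    by_cases h : γ ∈ T
    · rw [show x γ = (GExt.addEquiv₀ _ _).symm (homComponent f γ) from DirectSum.mk_apply_of_mem h]
      exact AddEquiv.apply_symm_apply _ _
    · rw [show x γ = 0 from DirectSum.mk_apply_of_notMem h, hT γ h]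
      exact map_zero (GExt.addEquiv₀ M (shift γ N))
  refine ⟨x, LinearMap.ext fun m => ?_⟩
  refine M.induction (p := fun m => uExtZeroToLin M N x m = f m) m (by simp) ?_
    (fun x y hx hy => by rw [map_add, map_add, hx, hy])
  intro i m hm
  refine N.ext_proj fun j => ?_
  have := proj_uExtZeroToLin M N x (j - i) i hm
  rw [hx, lin_homComponent f _ hm, sub_add_cancel] at this
  exact this

end HomComponents

section FinitePresentation

variable {K : Type*} {B : Type u} {G : Type w} [Field K] [Ring B] [Algebra K B]
  [AddCommGroup G] [DecidableEq G] {ℬ : G → Submodule K B}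

/-- `M` has a resolution by finitely generated projective graded modules up to degree `n`. -/
def FinitelyResolved : ℕ → GrMod.{v} ℬ → Prop
  | 0, M => Module.Finite B M.carrier
  | n + 1, M => ∃ (L P : GrMod.{v} ℬ) (g : L ⟶ P) (f : P ⟶ M), Projective P ∧
      Module.Finite B P.carrier ∧ Function.Injective (lin g) ∧ Function.Exact (lin g) (lin f) ∧
      Function.Surjective (lin f) ∧ FinitelyResolved n L

lemma finitelyResolved_of_exact (X : ℕ → GrMod.{v} ℬ) (d : ∀ i, X (i + 1) ⟶ X i)
    (hX : ∀ i, Projective (X i)) (hfin : ∀ i, Module.Finite B (X i).carrier)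
    (hd : ∀ i, Function.Exact (lin (d (i + 1))) (lin (d i))) (n : ℕ) {M : GrMod.{v} ℬ}
    (f : X 0 ⟶ M) (hf : Function.Surjective (lin f)) (hdf : Function.Exact (lin (d 0)) (lin f)) :
    FinitelyResolved n M := by
  induction n generalizing X M with
  | zero =>
    have := hfin 0
    exact Module.Finite.of_surjective _ hf
  | succ n ih =>
    refine ⟨ker f, X 0, (kerFork f).ι, f, hX 0, hfin 0, Subtype.val_injective,
      fun y => ⟨fun hy => ⟨⟨y, hy⟩, rfl⟩, ?_⟩, hf, ?_⟩
    · rintro ⟨x, rfl⟩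
      exact x.2
    · have hl : ∀ x, lin f (lin (d 0) x) = 0 := fun x => (hdf _).2 ⟨x, rfl⟩
      refine ih (fun i => X (i + 1)) (fun i => d (i + 1)) (fun i => hX _) (fun i => hfin _)
        (fun i => hd _) (M := ker f) (ofLin (N := ker f)
          ((lin (d 0)).codRestrict _ hl) fun _ _ hm => lin_mem (d 0) hm) ?_ ?_
      · rintro ⟨y, hy⟩
        obtain ⟨x, hx⟩ := (hdf y).1 hy
        exact ⟨x, Subtype.ext hx⟩
      · intro y
        exact Subtype.ext_iff.trans (hd 0 y)

lemma finitelyResolved_of_projectiveResolution {M : GrMod.{v} ℬ} (P : ProjectiveResolution M)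
    (hfin : ∀ i, Module.Finite B (P.complex.X i).carrier) (n : ℕ) : FinitelyResolved n M := by
  let π : P.complex.X 0 ⟶ M := P.π.f 0
  have hw : P.complex.d 1 0 ≫ π = 0 := P.complex_d_comp_π_f_zero
  have hπ : Epi π := inferInstanceAs (Epi (P.π.f 0))
  have hex : (ShortComplex.mk _ _ hw).Exact :=
    ShortComplex.exact_of_g_is_cokernel _ P.isColimitCokernelCofork
  exact finitelyResolved_of_exact P.complex.X (fun i => P.complex.d (i + 1) i) P.projective hfin
    (fun i => (exact_iff _).1 (P.exact_succ i)) n π (surjective_of_epi π) ((exact_iff _).1 hex)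

end FinitePresentation

end GrMod

lemma exists_directSum_map_eq {ι : Type*} {α β : ι → Type*} [∀ i, AddCommGroup (α i)]
    [∀ i, AddCommGroup (β i)] (f : ∀ i, α i →+ β i) (y : ⨁ i, β i)
    (h : ∀ i, ∃ x, f i x = y i) : ∃ x, DirectSum.map f x = y := by
  have : y ∈ AddMonoidHom.mrange (DirectSum.map f) := by
    rw [DirectSum.mrange_map]
    exact fun i _ => h i
  exact this

namespace GrMod

section Precomposition

variable {K : Type*} {B : Type u} {G : Type w} [Field K] [Ring B] [Algebra K B]
  [AddCommGroup G] [DecidableEq G] {ℬ : G → Submodule K B}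

/-- The composition of extension classes. -/
def GExt.comp {a n m : ℕ} {M M' N : GrMod.{v} ℬ} (α : GExt a M' M) (x : GExt n M N)
    (h : a + n = m) : GExt m M' N :=
  Ext.comp (α : Ext.{max w u (v + 1)} M' M a) x h

/-- A morphism of graded modules as an element of `Ext⁰`. -/
def GExt.mk₀ {M N : GrMod.{v} ℬ} (f : M ⟶ N) : GExt 0 M N := Ext.mk₀ f

/-- The extension class of a short exact sequence of graded modules. -/
def GExt.ofShortExact {S : ShortComplex (GrMod.{v} ℬ)} (hS : S.ShortExact) : GExt 1 S.X₃ S.X₁ :=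
  hS.extClass

lemma GExt.map_comp_class {a n m : ℕ} {M M' N N' : GrMod.{v} ℬ} (α : GExt a M' M) (x : GExt n M N)
    (h : a + n = m) (f : N ⟶ N') : GExt.map m M' f (α.comp x h) = α.comp (GExt.map n M f x) h :=
  Ext.comp_assoc_of_third_deg_zero (α : Ext.{max w u (v + 1)} M' M a) x (Ext.mk₀ f) h

/-- Precomposition with an extension class on graded Ext groups. -/
def uExtPrecomp {a n m : ℕ} {M M' : GrMod.{v} ℬ} (α : GExt a M' M) (N : GrMod.{v} ℬ)
    (h : a + n = m) : uExt n M N →+ uExt m M' N :=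
  DirectSum.map fun γ =>
    (Ext.precomp (α : Ext.{max w u (v + 1)} M' M a) (shift γ N) h : GExt n M (shift γ N) →+ _)

lemma uExtPrecomp_of {a n m : ℕ} {M M' : GrMod.{v} ℬ} (α : GExt a M' M) (N : GrMod.{v} ℬ)
    (h : a + n = m) (γ : G) (x : GExt n M (shift γ N)) :
    uExtPrecomp α N h (DirectSum.of (fun γ => GExt n M (shift γ N)) γ x) =
      DirectSum.of (fun γ => GExt m M' (shift γ N)) γ (α.comp x h) :=
  DirectSum.map_of _ _ _

lemma uExtPrecomp_extClass_exact {S : ShortComplex (GrMod.{v} ℬ)} (hS : S.ShortExact)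
    (N : GrMod.{v} ℬ) (n : ℕ) :
    Function.Exact (uExtPrecomp (GExt.mk₀ S.f) N (zero_add n))
      (uExtPrecomp (GExt.ofShortExact hS) N (add_comm 1 n)) := by
  intro y
  constructor
  · intro hy
    refine exists_directSum_map_eq _ _ fun γ => ?_
    refine Ext.contravariant_sequence_exact₁ hS (shift γ N) (y γ) (add_comm 1 n) ?_
    have := congrArg (fun z => z γ) hy
    exact this
  · rintro ⟨x, rfl⟩
    refine DirectSum.ext fun γ => ?_
    exact hS.extClass_comp_assoc (x γ) (h := add_comm 1 n)

lemma uExtPrecomp_extClass_surjective {S : ShortComplex (GrMod.{v} ℬ)} (hS : S.ShortExact)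
    [Projective S.X₂] (N : GrMod.{v} ℬ) (n : ℕ) :
    Function.Surjective (uExtPrecomp (GExt.ofShortExact hS) N (add_comm 1 n)) :=
  fun y => exists_directSum_map_eq _ _ fun γ =>
    Ext.contravariant_sequence_exact₃ hS (shift γ N) (y γ) (Ext.eq_zero_of_projective _) (add_comm 1 n)

lemma subsingleton_uExt_succ (P N : GrMod.{v} ℬ) [Projective P] (n : ℕ) :
    Subsingleton (uExt (n + 1) P N) :=
  subsingleton_of_forall_eq 0 fun _ => DirectSum.ext fun _ => Ext.eq_zero_of_projective _

end Precomposition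

section Comparison

variable {K : Type*} {B : Type u} {G : Type w} {H : Type w'} [Field K] [Ring B] [Algebra K B]
  [AddCommGroup G] [DecidableEq G] [AddCommGroup H] [DecidableEq H]
  {ℬ : G → Submodule K B} {ℬ' : H → Submodule K B} {φ : G →+ H}
  [GradedAlgebra ℬ] [GradedAlgebra ℬ'] (hℬ : ℬ' = regrade φ ℬ)

/-- The identity of `B`, from the regrading of `Σ_γ B` to `Σ_{φ γ} B`. -/
def regradeShiftSelf (γ : G) :
    (regradeFunctor hℬ).obj (shift γ (self ℬ)) ⟶ shift (φ γ) (self ℬ') :=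
  regradeDesc hℬ (M := shift γ (self ℬ)) (N := shift (φ γ) (self ℬ'))
    (LinearMap.id : B →ₗ[B] B) fun i m (hm : (show B from m) ∈ ℬ (γ + i)) => by
      subst hℬ
      exact mem_regrade φ ℬ (map_add φ γ i) hm

/-- The map induced on Ext groups by the regrading functor. -/
def mapGExt (n : ℕ) (M N : GrMod.{v} ℬ) :
    GExt n M N →+ GExt n ((regradeFunctor hℬ).obj M) ((regradeFunctor hℬ).obj N) :=
  (regradeFunctor hℬ).mapExtAddHom M N n

lemma mapGExt_comp {a n m : ℕ} {M M' N : GrMod.{v} ℬ} (α : GExt a M' M) (x : GExt n M N)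
    (h : a + n = m) : mapGExt hℬ m M' N (α.comp x h) =
      (mapGExt hℬ a M' M α).comp (mapGExt hℬ n M N x) h :=
  Ext.mapExactFunctor_comp (regradeFunctor hℬ) (α : Ext.{max w u (v + 1)} M' M a) x h

lemma mapGExt_mk₀ {M N : GrMod.{v} ℬ} (f : M ⟶ N) :
    mapGExt hℬ 0 M N (GExt.mk₀ f) = GExt.mk₀ ((regradeFunctor hℬ).map f) :=
  Ext.mapExactFunctor_mk₀ _ _

lemma mapGExt_map (n : ℕ) {M N N' : GrMod.{v} ℬ} (f : N ⟶ N') (x : GExt n M N) :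
    mapGExt hℬ n M N' (GExt.map n M f x) =
      GExt.map n _ ((regradeFunctor hℬ).map f) (mapGExt hℬ n M N x) :=
  (mapGExt_comp hℬ x (GExt.mk₀ f) (add_zero n)).trans
    (congrArg (GExt.comp _ · (add_zero n)) (mapGExt_mk₀ hℬ f))

/-- The comparison map of Ext groups with values in a shift of `B`. -/
def regradeGExt (n : ℕ) (M : GrMod.{u} ℬ) (γ : G) :
    GExt n M (shift γ (self ℬ)) →+
      GExt n ((regradeFunctor hℬ).obj M) (shift (φ γ) (self ℬ')) :=
  (GExt.map n _ (regradeShiftSelf hℬ γ)).comp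
    (mapGExt hℬ n M (shift γ (self ℬ)))

/-- The comparison map of graded Ext groups with values in `B`. -/
def regradeUExt (n : ℕ) (M : GrMod.{u} ℬ) :
    uExt n M (self ℬ) →+ uExt n ((regradeFunctor hℬ).obj M) (self ℬ') :=
  DirectSum.toAddMonoid fun γ =>
    (DirectSum.of (fun δ => GExt n ((regradeFunctor hℬ).obj M) (shift δ (self ℬ'))) (φ γ)).comp
      (regradeGExt hℬ n M γ)

lemma regradeUExt_of (n : ℕ) (M : GrMod.{u} ℬ) (γ : G) (x : GExt n M (shift γ (self ℬ))) :
    regradeUExt hℬ n M (DirectSum.of (fun γ => GExt n M (shift γ (self ℬ))) γ x) =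
      DirectSum.of (fun δ => GExt n ((regradeFunctor hℬ).obj M) (shift δ (self ℬ'))) (φ γ)
        (regradeGExt hℬ n M γ x) :=
  DirectSum.toAddMonoid_of _ _ _

lemma regradeUExt_precomp {a n m : ℕ} {M M' : GrMod.{u} ℬ} (α : GExt a M' M) (h : a + n = m)
    (x : uExt n M (self ℬ)) :
    regradeUExt hℬ m M' (uExtPrecomp α (self ℬ) h x) =
      uExtPrecomp (mapGExt hℬ a M' M α) (self ℬ') h (regradeUExt hℬ n M x) := by
  induction x using DirectSum.induction_on with
  | zero => simp only [map_zero]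
  | add x y hx hy => simp only [map_add, hx, hy]
  | of γ x =>
    rw [uExtPrecomp_of, regradeUExt_of, regradeUExt_of, uExtPrecomp_of]
    congr 1
    rw [regradeGExt, AddMonoidHom.comp_apply, mapGExt_comp, GExt.map_comp_class]
    rfl

lemma regradeUExt_right (n : ℕ) (M : GrMod.{u} ℬ) (b : B) (x : uExt n M (self ℬ)) :
    regradeUExt hℬ n M (uExtRight n M b x) =
      uExtRight n ((regradeFunctor hℬ).obj M) b (regradeUExt hℬ n M x) := by
  refine DirectSum.Decomposition.inductionOn ℬ (motive := fun b =>
    regradeUExt hℬ n M (uExtRight n M b x) =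
      uExtRight n ((regradeFunctor hℬ).obj M) b (regradeUExt hℬ n M x)) (by simp) ?_
    (fun b c hb hc => by simp only [map_add, AddMonoidHom.add_apply, hb, hc]) b
  intro δ b
  induction x using DirectSum.induction_on with
  | zero => simp only [map_zero]
  | add x y hx hy => simp only [map_add, hx, hy]
  | of γ x =>
    have hb : (b : B) ∈ ℬ' (φ δ) := by
      subst hℬ
      exact mem_regrade φ ℬ rfl b.2
    rw [uExtRight_of_mem n M b.2, uExtRightHom_of n M rfl, regradeUExt_of, regradeUExt_of,
      uExtRight_of_mem n _ hb, uExtRightHom_of n _ (map_add φ γ δ).symm]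
    congr 1
    have hw : (regradeFunctor hℬ).map (rmul (γ := γ) rfl b) ≫ regradeShiftSelf hℬ (γ + δ) =
        regradeShiftSelf hℬ γ ≫ rmul (map_add φ γ δ).symm ⟨b, hb⟩ := hom_ext fun _ => rfl
    refine Eq.trans ?_ (GExt.map_comp n _ _ _ _)
    rw [← hw, GExt.map_comp]
    exact congrArg (GExt.map n _ (regradeShiftSelf hℬ (γ + δ))) (mapGExt_map hℬ n _ x)

lemma uExtZeroToLin_regradeUExt (M : GrMod.{u} ℬ) (x : uExt 0 M (self ℬ)) :
    uExtZeroToLin ((regradeFunctor hℬ).obj M) (self ℬ') (regradeUExt hℬ 0 M x) =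
      uExtZeroToLin M (self ℬ) x := by
  induction x using DirectSum.induction_on with
  | zero => simp only [map_zero]; rfl
  | add x y hx hy => simp only [map_add, hx, hy]; rfl
  | of γ x =>
    obtain ⟨f, rfl⟩ := (GExt.addEquiv₀ _ _).symm.surjective x
    have h : regradeGExt hℬ 0 M γ ((GExt.addEquiv₀ _ _).symm f) =
        (GExt.addEquiv₀ _ _).symm ((regradeFunctor hℬ).map f ≫ regradeShiftSelf hℬ γ) :=
      (congrArg (GExt.map 0 _ (regradeShiftSelf hℬ γ)) (mapGExt_mk₀ hℬ f)).trans
        (Ext.mk₀_comp_mk₀ _ _)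
    rw [regradeUExt_of, h, uExtZeroToLin_of, uExtZeroToLin_of, AddEquiv.apply_symm_apply,
      AddEquiv.apply_symm_apply]
    rfl

lemma regradeUExt_zero_bijective (M : GrMod.{u} ℬ) [Module.Finite B M.carrier] :
    Function.Bijective (regradeUExt hℬ 0 M) := by
  constructor
  · intro x y h
    refine uExtZeroToLin_injective M (self ℬ) ?_
    rw [← uExtZeroToLin_regradeUExt hℬ, ← uExtZeroToLin_regradeUExt hℬ, h]
  · intro y
    obtain ⟨x, hx⟩ := uExtZeroToLin_surjective M (self ℬ)
      (uExtZeroToLin ((regradeFunctor hℬ).obj M) (self ℬ') y)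
    refine ⟨x, uExtZeroToLin_injective _ _ ?_⟩
    rw [uExtZeroToLin_regradeUExt hℬ, hx]

/-- The graded Ext groups of a module with a resolution by finitely generated projectives do not
change under regrading. -/
theorem regradeUExt_bijective (n : ℕ) (M : GrMod.{u} ℬ) (hM : FinitelyResolved n M) :
    Function.Bijective (regradeUExt hℬ n M) := by
  induction n generalizing M with
  | zero =>
    have : Module.Finite B M.carrier := hM
    exact regradeUExt_zero_bijective hℬ M
  | succ n ih =>
    obtain ⟨L, P, g, f, hP, hfin, hg, hgf, hf, hL⟩ := hM
    let S : ShortComplex (GrMod.{u} ℬ) :=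
      ShortComplex.mk g f (hom_ext fun x => (hgf _).2 ⟨x, rfl⟩)
    have hS : S.ShortExact := (shortExact_iff S).2 ⟨hg, hgf, hf⟩
    have hS' : (S.map (regradeFunctor hℬ)).ShortExact := hS.map_of_exact _
    have : Projective S.X₂ := hP
    have : Projective (S.map (regradeFunctor hℬ)).X₂ :=
      (regradeFunctor hℬ).projective_obj_of_projective hP
    have hcls : mapGExt hℬ 1 _ _ (GExt.ofShortExact hS) = GExt.ofShortExact hS' :=
      Ext.mapExactFunctor_extClass _ hS
    have hPn : Function.Surjective (regradeUExt hℬ n P) := by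
      cases n with
      | zero => exact (regradeUExt_zero_bijective hℬ P).2
      | succ n =>
        have := subsingleton_uExt_succ ((regradeFunctor hℬ).obj P) (self ℬ') n
        exact fun y => ⟨0, Subsingleton.elim _ _⟩
    have hδ : ∀ x, regradeUExt hℬ (n + 1) M
        (uExtPrecomp (GExt.ofShortExact hS) (self ℬ) (add_comm 1 n) x) =
          uExtPrecomp (GExt.ofShortExact hS') (self ℬ') (add_comm 1 n) (regradeUExt hℬ n L x) :=
      fun x => (regradeUExt_precomp hℬ _ _ x).trans (by rw [hcls]; rfl)
    constructor
    · rw [injective_iff_map_eq_zero]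
      intro x hx
      obtain ⟨x, rfl⟩ := uExtPrecomp_extClass_surjective hS (self ℬ) n x
      rw [hδ] at hx
      obtain ⟨y, hy⟩ := (uExtPrecomp_extClass_exact hS' (self ℬ') n _).1 hx
      obtain ⟨y, rfl⟩ := hPn y
      have hxy : uExtPrecomp (GExt.mk₀ S.f) (self ℬ) (zero_add n) y = x := by
        refine (ih L hL).1 ((regradeUExt_precomp hℬ _ _ y).trans ?_)
        rw [mapGExt_mk₀]
        exact hy
      exact (uExtPrecomp_extClass_exact hS (self ℬ) n x).2 ⟨y, hxy⟩
    · intro y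
      obtain ⟨y, rfl⟩ := uExtPrecomp_extClass_surjective hS' (self ℬ') n y
      obtain ⟨x, rfl⟩ := (ih L hL).2 y
      exact ⟨_, hδ x⟩

end Comparison

end GrMod

namespace GrMod

section Transport

variable {K : Type*} {B : Type u} {G : Type w} [Field K] [Ring B] [Algebra K B]
  [AddCommGroup G] [DecidableEq G] {ℬ : G → Submodule K B}

lemma uExtPrecomp_mk₀_bijective {M M' : GrMod.{v} ℬ} (i : M' ≅ M) (N : GrMod.{v} ℬ) (n : ℕ) :
    Function.Bijective (uExtPrecomp (GExt.mk₀ i.hom) N (zero_add n)) := by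
  have h : ∀ {L L' : GrMod.{v} ℬ} (j : L' ≅ L) (x : uExt n L' N),
      uExtPrecomp (GExt.mk₀ j.hom) N (zero_add n)
        (uExtPrecomp (GExt.mk₀ j.inv) N (zero_add n) x) = x := by
    refine fun {L L'} j x => DirectSum.ext fun γ => ?_
    refine (Ext.mk₀_comp_mk₀_assoc j.hom j.inv (x γ)).trans ?_
    rw [j.hom_inv_id]
    exact Ext.mk₀_id_comp _
  exact ⟨Function.LeftInverse.injective (h i.symm), Function.RightInverse.surjective (h i)⟩

lemma uExtPrecomp_right [GradedAlgebra ℬ] {a n m : ℕ} {M M' : GrMod.{u} ℬ} (α : GExt a M' M)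
    (h : a + n = m) (b : B) (x : uExt n M (self ℬ)) :
    uExtPrecomp α (self ℬ) h (uExtRight n M b x) =
      uExtRight m M' b (uExtPrecomp α (self ℬ) h x) := by
  refine DirectSum.Decomposition.inductionOn ℬ (motive := fun b =>
    uExtPrecomp α (self ℬ) h (uExtRight n M b x) =
      uExtRight m M' b (uExtPrecomp α (self ℬ) h x)) (by simp) ?_
    (fun b c hb hc => by simp only [map_add, AddMonoidHom.add_apply, hb, hc]) b
  intro δ b
  induction x using DirectSum.induction_on with
  | zero => simp only [map_zero]
  | add x y hx hy => simp only [map_add, hx, hy]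
  | of γ x =>
    rw [uExtRight_of_mem n M b.2, uExtRightHom_of n M rfl, uExtPrecomp_of, uExtPrecomp_of,
      uExtRight_of_mem m M' b.2, uExtRightHom_of m M' rfl, GExt.map_comp_class]

lemma mem_gr_iff_of_symm_mem {M : GrMod.{v₁} ℬ} {N : GrMod.{v₂} ℬ} (e : M.carrier ≃+ N.carrier)
    (h : ∀ i, ∀ y ∈ N.gr i, e.symm y ∈ M.gr i) (i : G) (x : M.carrier) :
    e x ∈ N.gr i ↔ x ∈ M.gr i := by
  have hproj : ∀ y, e.symm (N.proj i y) = M.proj i (e.symm y) := by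
    intro y
    refine N.induction (p := fun y => e.symm (N.proj i y) = M.proj i (e.symm y)) y (by simp) ?_
      (fun x y hx hy => by simp only [map_add, hx, hy])
    intro j y hy
    by_cases hj : j = i
    · subst hj
      rw [proj_same N hy, proj_same M (h _ _ hy)]
    · rw [proj_ne N hy hj, proj_ne M (h _ _ hy) hj, map_zero]
  refine ⟨fun hx => e.symm_apply_apply x ▸ h i _ hx, fun hx => ?_⟩
  have : N.proj i (e x) = e x := e.symm.injective (by
    rw [hproj, e.symm_apply_apply, proj_same M hx])
  exact this ▸ N.proj_mem i (e x)

end Transport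

end GrMod

section Main

open GrMod

variable {K : Type*} {A : Type u} {G : Type w} {H : Type w'} [Field K] [Ring A] [Algebra K A]
  [AddCommGroup G] [DecidableEq G] [AddCommGroup H] [DecidableEq H] (φ : G →+ H)
  (𝒜 : G → Submodule K A)

lemma envGrading_regrade : envGrading (regrade φ 𝒜) = regrade φ (envGrading 𝒜) := by
  funext δ
  refine le_antisymm (envGrading_le fun α β h a ha b hb => ?_)
    (regrade_le φ _ fun γ hγ => envGrading_le fun α β h a ha b hb => ?_)
  · have h₁ : regrade φ 𝒜 α ≤ (regrade φ (envGrading 𝒜) δ).comap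
        ((TensorProduct.mk K A Aᵐᵒᵖ).flip b) := by
      refine regrade_le φ 𝒜 fun γ hγ a ha => ?_
      have h₂ : regrade φ 𝒜 β ≤ (regrade φ (envGrading 𝒜) δ).comap
          (TensorProduct.mk K A Aᵐᵒᵖ a ∘ₗ
            (MulOpposite.opLinearEquiv K : A ≃ₗ[K] Aᵐᵒᵖ).toLinearMap) := by
        refine regrade_le φ 𝒜 fun γ' hγ' b hb => ?_
        exact mem_regrade φ _ (by rw [map_add, hγ, hγ', h])
          (tmul_mem_envGrading rfl ha (mem_opGrading.2 hb))
      exact h₂ (mem_opGrading.1 hb)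
    exact h₁ ha
  · exact tmul_mem_envGrading (by rw [← map_add, h, hγ]) (mem_regrade φ 𝒜 rfl ha)
      (mem_opGrading.2 (mem_regrade φ 𝒜 rfl hb))

variable [GradedAlgebra 𝒜]

/-- The diagonal bimodule of the regraded algebra is the regraded diagonal bimodule. -/
def diagonalRegradeIso : diagonal (regrade φ 𝒜) ≅
    (regradeFunctor (envGrading_regrade φ 𝒜)).obj (diagonal 𝒜) where
  hom := ofLin (M := diagonal (regrade φ 𝒜))
    (N := (regradeFunctor (envGrading_regrade φ 𝒜)).obj (diagonal 𝒜)) LinearMap.id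
    fun _ _ hm => regrade_le_addSubgroup φ 𝒜
      (fun _ hγ _ ha => mem_regradeGr φ (diagonal 𝒜) hγ ha) hm
  inv := regradeDesc (envGrading_regrade φ 𝒜) (M := diagonal 𝒜) (N := diagonal (regrade φ 𝒜))
    LinearMap.id fun _ _ hm => mem_regrade φ 𝒜 rfl hm
  hom_inv_id := rfl
  inv_hom_id := rfl

lemma HomologicallySmooth.regrade (h : HomologicallySmooth 𝒜) :
    HomologicallySmooth (regrade φ 𝒜) := by
  obtain ⟨P, ⟨n, hn⟩, hfin⟩ := h
  let Φ := regradeFunctor.{u} (envGrading_regrade φ 𝒜)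
  let Q : ProjectiveResolution (Φ.obj (diagonal 𝒜)) := Φ.mapProjectiveResolution P
  let Q' : ProjectiveResolution (diagonal (SkewCY.regrade φ 𝒜)) :=
    { complex := Q.complex
      projective := Q.projective
      π := Q.π ≫ (ChainComplex.single₀ _).map (diagonalRegradeIso φ 𝒜).inv }
  exact ⟨Q', ⟨n, fun i hi => Φ.map_isZero (hn i hi)⟩, hfin⟩

/-- The comparison map of the graded groups `uExt^n(A, Aᵉ)`. -/
def regradeExtBimodule (n : ℕ) :
    (extBimodule 𝒜 n).carrier →ₗ[A ⊗[K] Aᵐᵒᵖ] (extBimodule (regrade φ 𝒜) n).carrier where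
  toFun x := uExtPrecomp (GExt.mk₀ (diagonalRegradeIso φ 𝒜).hom) _ (zero_add n)
    (regradeUExt (envGrading_regrade φ 𝒜) n (diagonal 𝒜) x)
  map_add' _ _ := by
    refine Eq.trans ?_ (map_add _ _ _)
    exact congrArg _ (map_add _ _ _)
  map_smul' t x := by
    refine Eq.trans ?_ (uExtPrecomp_right (GExt.mk₀ (diagonalRegradeIso φ 𝒜).hom) (zero_add n)
      (envAnti K A t).unop _)
    exact congrArg _ (regradeUExt_right (envGrading_regrade φ 𝒜) n (diagonal 𝒜)
      (envAnti K A t).unop x)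

lemma regradeExtBimodule_bijective (h : HomologicallySmooth 𝒜) (n : ℕ) :
    Function.Bijective (regradeExtBimodule φ 𝒜 n) := by
  obtain ⟨P, -, hfin⟩ := h
  exact (uExtPrecomp_mk₀_bijective (diagonalRegradeIso φ 𝒜) _ n).comp
    (regradeUExt_bijective _ n _ (finitelyResolved_of_projectiveResolution P hfin n))

lemma regradeExtBimodule_mem (n : ℕ) {γ : G} {x : (extBimodule 𝒜 n).carrier}
    (hx : x ∈ (extBimodule 𝒜 n).gr γ) :
    regradeExtBimodule φ 𝒜 n x ∈ (extBimodule (regrade φ 𝒜) n).gr (φ γ) := by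
  obtain ⟨x, rfl⟩ := hx
  refine ⟨GExt.comp (GExt.mk₀ (diagonalRegradeIso φ 𝒜).hom)
    (regradeGExt (envGrading_regrade φ 𝒜) n (diagonal 𝒜) γ x) (zero_add n), ?_⟩
  refine (uExtPrecomp_of _ _ _ _ _).symm.trans ?_
  exact congrArg (uExtPrecomp _ _ (zero_add n)) (regradeUExt_of _ _ _ _ _).symm

variable {𝒜} in
lemma IsNakayama.regrade (h : HomologicallySmooth 𝒜) {d : ℕ} {μ : gradedAut 𝒜} {l : G}
    (hμ : IsNakayama 𝒜 d μ l) :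
    IsNakayama (regrade φ 𝒜) d (gradedAut.regrade φ μ) (φ l) := by
  refine ⟨fun i hi => ?_, ?_⟩
  · have := hμ.1 i hi
    exact (regradeExtBimodule_bijective φ 𝒜 h i).2.subsingleton
  · obtain ⟨e, he⟩ := hμ.2
    let θ := LinearEquiv.ofBijective _ (regradeExtBimodule_bijective φ 𝒜 h d)
    let e' : (extBimodule (SkewCY.regrade φ 𝒜) d).carrier ≃ₗ[A ⊗[K] Aᵐᵒᵖ]
      (shift (φ l) (twist 1 (gradedAut.regrade φ μ) (diagonal (SkewCY.regrade φ 𝒜)))).carrier :=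
      θ.symm.trans e
    refine ⟨e', mem_gr_iff_of_symm_mem e'.toAddEquiv fun δ y hy => ?_⟩
    refine regrade_le_addSubgroup φ 𝒜 (S := ((extBimodule (SkewCY.regrade φ 𝒜) d).gr δ).comap
      (e'.symm.toLinearMap.toAddMonoidHom : A →+ _)) (fun γ hγ a ha => ?_) hy
    have hmem : a ∈ (shift l (twist 1 μ (diagonal 𝒜))).gr (γ - l) := by
      change a ∈ 𝒜 (l + (γ - l))
      rwa [add_sub_cancel]
    have := regradeExtBimodule_mem φ 𝒜 d ((he (γ - l) (e.symm a)).1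
      ((e.apply_symm_apply a).symm ▸ hmem))
    rwa [map_sub, hγ, add_sub_cancel_left] at this

end Main

end SkewCY

end

theorem mainTheorem6 {K : Type*} {A : Type*} {G : Type*} {H : Type*} [Field K] [Ring A]
    [Algebra K A] [AddCommGroup G] [DecidableEq G] [AddCommGroup H] [DecidableEq H]
    (𝒜 : G → Submodule K A) [GradedAlgebra 𝒜] (φ : G →+ H) (d : ℕ)
    (hA : SkewCY.IsSkewCalabiYau 𝒜 d) :
    SkewCY.IsSkewCalabiYau (SkewCY.regrade φ 𝒜) d ∧
      ∀ (μ : SkewCY.gradedAut 𝒜) (l : G), SkewCY.IsNakayama 𝒜 d μ l →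
        SkewCY.IsNakayama (SkewCY.regrade φ 𝒜) d (SkewCY.gradedAut.regrade φ μ) (φ l) := by
  obtain ⟨hs, μ, l, hμ⟩ := hA
  exact ⟨⟨hs.regrade φ, SkewCY.gradedAut.regrade φ μ, φ l, hμ.regrade φ hs⟩,
    fun _ _ hν => hν.regrade φ hs⟩
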